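/- **Definitions.** Let $\mu$ be a $\sigma$-finite measure on $\Omega$ and $L_0(\mu)$ the space of $\mu$-a.e. classes of real-valued measurable functions. A *quasi Köthe function space* $X(\mu)$ is a linear subspace of $L_0(\mu)$ with a quasi norm $\|\cdot\|_X$ such that: (I) if $x\in L_0(\mu)$, $y\in X$ and $|x|\le|y|$ a.e., then $x\in X$ and $\|x\|_X\le\|y\|_X$; (II) for some $0<s<\infty$, $\|(|x|^s+|y|^s)^{1/s}\|_X\le(\|x\|_X^s+\|y\|_X^s)^{1/s}$ for all $x,y\in X$; (III) every measurable set containing, up to null sets, the supports of all functions in $X$ has a null complement, and $\|x_n\|_X\to\|x\|_X$ whenever $x_n,x\in X$ and $0\le x_n\uparrow x$ a.e. It is *$\sigma$-order continuous* if $\|x_n\|_X\to0$ whenever $x_n\in X$ and $0\le x_n\downarrow0$ a.e. For $0<r<\infty$ it is *$r$-convex* if there is $c\ge0$ with $\|(\sum_k|x_k|^r)^{1/r}\|_X\le c(\sum_k\|x_k\|_X^r)^{1/r}$ for all finite families $x_1,\dots,x_n$ in $X$; the best such $c$ is denoted $M^{(r)}(X)$. The *$r$-th power* of $X$ is $X^r=\{x\in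 L_0(\mu): |x|^{1/r}\in X\}$ with the quasi norm $\|x\|_{X^r}=\||x|^{1/r}\|_X^r$. The *Köthe dual* $Y^\times$ of $Y(\mu)$ consists of all $g\in L_0(\mu)$ such that $xg$ is integrable for all $x\in Y$ and $\sup_{\|x\|_Y\le1}|\int xg\,d\mu|<\infty$. A *homogeneous set* is a set $U$ with a multiplication $[0,\infty)\times U\to U$, $(\lambda,x)\mapsto\lambda x$. **Theorem.** Let $0<r_1,r_2<\infty$ and $\frac1t=\frac1{r_1}+\frac1{r_2}$. Let $U_1,U_2$ be homogeneous sets, $\mathbb K\in\{\mathbb R,\mathbb C\}$, and let $u:U_1\times U_2\to\mathbb K$ satisfy $u(\lambda x,y)=u(x,\lambda y)=\lambda u(x,y)$ for all $\lambda\ge0$, $x\in U_1$, $y\in U_2$. For $\ell=1,2$ let $X_\ell(\mu_\ell)$ be an $r_\ell$-convex quasi Köthe function space over a $\sigma$-finite measure $\mu_\ell$, and let $\phi_\ell:U_\ell\to X_\ell$ satisfy $\phi_\ell(\lambda x)=\lambda\phi_\ell(x)$ for all $\lambda\ge0$, $x\in U_\ell$. Assume that $$\Big(\sum_{k=1}^n|u(x_k,y_k)|^t\Big)^{1/t}\le\Big\|\Big(\sum_{k=1}^n|\phi_1(x_k)|^{r_1}\Big)^{1/r_1}\Big\|_{X_1}\Big\|\Big(\sum_{k=1}^n|\phi_2(y_k)|^{r_2}\Big)^{1/r_2}\Big\|_{X_2}$$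 for all $n$ and all $x_1,\dots,x_n\in U_1$, $y_1,\dots,y_n\in U_2$. Then there are positive linear functionals $\varphi_\ell:X_\ell^{r_\ell}\to\mathbb R$ $(\ell=1,2)$ with $$\sup_{\|x\|_{X_\ell}\le1}\varphi_\ell(|x|^{r_\ell})^{1/r_\ell}\le M^{(r_\ell)}(X_\ell)$$ such that for all $x\in U_1$ and $y\in U_2$ $$|u(x,y)|\le\varphi_1(|\phi_1(x)|^{r_1})^{1/r_1}\,\varphi_2(|\phi_2(y)|^{r_2})^{1/r_2}.$$ Moreover, for each $\ell$ for which $X_\ell$ is $\sigma$-order continuous, $\varphi_\ell$ can be chosen to be a function in the Köthe dual of $X_\ell^{r_\ell}$, i.e. $\varphi_\ell(f)=\int fg_\ell\,d\mu_\ell$ for all $f\in X_\ell^{r_\ell}$ with some $0\le g_\ell\in(X_\ell^{r_\ell})^\times$. -/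

import Mathlib

open MeasureTheory Filter Topology
open scoped NNReal

namespace Kothe

variable {Ω : Type*} [MeasurableSpace Ω] {μ : Measure Ω}

/-- The class `|f|^r` of an element `f` of `L₀(μ)`. -/
noncomputable def absRpow (r : ℝ) (f : Ω →ₘ[μ] ℝ) : Ω →ₘ[μ] ℝ :=
  f.compMeasurable (fun s => |s| ^ r) ((measurable_id.abs).pow_const r)

/-- The class `(∑ₖ |xₖ|^r)^(1/r)`. -/
noncomputable def lrSum (r : ℝ) {n : ℕ} (x : Fin n → (Ω →ₘ[μ] ℝ)) : Ω →ₘ[μ] ℝ :=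
  absRpow (1 / r) (∑ k, absRpow r (x k))

theorem coeFn_absRpow (r : ℝ) (f : Ω →ₘ[μ] ℝ) :
    ∀ᵐ ω ∂μ, absRpow r f ω = |f ω| ^ r :=
  AEEqFun.coeFn_compMeasurable _ _ f

/-- A quasi Köthe function space over `μ`: a linear subspace `carrier` of `L₀(μ)` with a quasi norm.
The map `qnorm` is the quasi norm on `carrier`; its values outside `carrier` carry no meaning. -/
structure QuasiKotheSpace (μ : Measure Ω) where
  /-- the underlying vector space of classes of functions -/
  carrier : Submodule ℝ (Ω →ₘ[μ] ℝ)
  /-- the quasi norm -/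
  qnorm : (Ω →ₘ[μ] ℝ) → ℝ
  qnorm_nonneg : ∀ x ∈ carrier, 0 ≤ qnorm x
  qnorm_eq_zero : ∀ x ∈ carrier, (qnorm x = 0 ↔ x = 0)
  qnorm_smul : ∀ (a : ℝ), ∀ x ∈ carrier, qnorm (a • x) = |a| * qnorm x
  qnorm_add : ∃ C : ℝ, 0 ≤ C ∧
    ∀ x ∈ carrier, ∀ y ∈ carrier, qnorm (x + y) ≤ C * (qnorm x + qnorm y)
  /-- the space is solid and the quasi norm is monotone -/
  solid : ∀ x : Ω →ₘ[μ] ℝ, ∀ y ∈ carrier, (∀ᵐ ω ∂μ, |x ω| ≤ |y ω|) →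
    x ∈ carrier ∧ qnorm x ≤ qnorm y
  /-- `t`-convexity of the quasi norm with constant `1` for some `t > 0` -/
  convex : ∃ t : ℝ, 0 < t ∧ ∀ x ∈ carrier, ∀ y ∈ carrier,
    qnorm (absRpow (1 / t) (absRpow t x + absRpow t y)) ≤ (qnorm x ^ t + qnorm y ^ t) ^ (1 / t)
  /-- the support of the space is all of `Ω`: a measurable set which contains, up to null sets, the supports
  of all functions in the space has a null complement -/
  full_support : ∀ S : Set Ω, MeasurableSet S →
    (∀ x ∈ carrier, ∀ᵐ ω ∂μ, ω ∉ S → x ω = 0) → μ Sᶜ = 0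
  /-- the Fatou property -/
  fatou : ∀ (x : ℕ → (Ω →ₘ[μ] ℝ)), ∀ y ∈ carrier, (∀ n, x n ∈ carrier) →
    (∀ n, 0 ≤ x n) → (∀ᵐ ω ∂μ, Monotone fun n => x n ω) →
    (∀ᵐ ω ∂μ, Tendsto (fun n => x n ω) atTop (𝓝 (y ω))) →
    Tendsto (fun n => qnorm (x n)) atTop (𝓝 (qnorm y))

namespace QuasiKotheSpace

/-- `σ`-order continuity: `‖xₙ‖ → 0` whenever `0 ≤ xₙ ↓ 0` almost everywhere. -/
def SigmaOrderContinuous (X : QuasiKotheSpace μ) : Prop :=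
  ∀ x : ℕ → (Ω →ₘ[μ] ℝ), (∀ n, x n ∈ X.carrier) → (∀ n, 0 ≤ x n) →
    (∀ᵐ ω ∂μ, Antitone fun n => x n ω) →
    (∀ᵐ ω ∂μ, Tendsto (fun n => x n ω) atTop (𝓝 0)) →
    Tendsto (fun n => X.qnorm (x n)) atTop (𝓝 0)

/-- The admissible constants in the definition of `r`-convexity. -/
def convexityConstants (X : QuasiKotheSpace μ) (r : ℝ) : Set ℝ :=
  {c | 0 ≤ c ∧ ∀ (n : ℕ) (x : Fin n → (Ω →ₘ[μ] ℝ)), (∀ k, x k ∈ X.carrier) →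
    X.qnorm (lrSum r x) ≤ c * (∑ k, X.qnorm (x k) ^ r) ^ (1 / r)}

/-- `X` is `r`-convex. -/
def IsRConvex (X : QuasiKotheSpace μ) (r : ℝ) : Prop := (X.convexityConstants r).Nonempty

/-- The best constant `M^{(r)}(X)` of an `r`-convex space. -/
noncomputable def convexityConst (X : QuasiKotheSpace μ) (r : ℝ) : ℝ :=
  sInf (X.convexityConstants r)

/-- Membership of `y` in the Köthe dual `X^×`: the products `x y` with `x ∈ X` are integrable and
`sup_{‖x‖ ≤ 1} |∫ x y dμ| < ∞`. -/
def MemKotheDual (X : QuasiKotheSpace μ) (y : Ω →ₘ[μ] ℝ) : Prop :=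
  (∀ x ∈ X.carrier, Integrable (fun ω => x ω * y ω) μ) ∧
    ∃ C : ℝ, ∀ x ∈ X.carrier, X.qnorm x ≤ 1 → |∫ ω, x ω * y ω ∂μ| ≤ C

theorem rpow_add_le_aux {r : ℝ} (hr : 0 < r) {a b : ℝ} (ha : 0 ≤ a) (hb : 0 ≤ b) :
    (a + b) ^ r ≤ 2 ^ r * (a ^ r + b ^ r) := by
  have h1 : a + b ≤ 2 * max a b := by
    have := le_max_left a b
    have := le_max_right a b
    linarith
  have h2 : (max a b) ^ r ≤ a ^ r + b ^ r := by
    have := Real.rpow_nonneg ha r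
    have := Real.rpow_nonneg hb r
    rcases max_choice a b with h | h <;> rw [h] <;> linarith
  calc (a + b) ^ r ≤ (2 * max a b) ^ r := Real.rpow_le_rpow (by positivity) h1 hr.le
    _ = 2 ^ r * (max a b) ^ r := Real.mul_rpow (by norm_num) (le_max_of_le_left ha)
    _ ≤ _ := by gcongr

theorem absRpow_mem (X : QuasiKotheSpace μ) {r : ℝ} (hr : 0 < r) {x : Ω →ₘ[μ] ℝ}
    (hx : x ∈ X.carrier) : absRpow (1 / r) (absRpow r x) ∈ X.carrier := by
  refine (X.solid _ x hx ?_).1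
  filter_upwards [coeFn_absRpow (1 / r) (absRpow r x), coeFn_absRpow r x] with ω h1 h2
  rw [h1, h2, abs_of_nonneg (Real.rpow_nonneg (abs_nonneg (x ω)) r),
    ← Real.rpow_mul (abs_nonneg _), mul_one_div_cancel hr.ne', Real.rpow_one, abs_abs]

theorem power_add_aux (X : QuasiKotheSpace μ) {r : ℝ} (hr : 0 < r) {x y : Ω →ₘ[μ] ℝ}
    (hx : absRpow (1 / r) x ∈ X.carrier) (hy : absRpow (1 / r) y ∈ X.carrier) :
    absRpow (1 / r) (x + y) ∈ X.carrier ∧ X.qnorm (absRpow (1 / r) (x + y)) ≤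
      X.qnorm ((2 : ℝ) ^ (1 / r) • (absRpow (1 / r) x + absRpow (1 / r) y)) := by
  refine X.solid _ _ (X.carrier.smul_mem _ (X.carrier.add_mem hx hy)) ?_
  filter_upwards [coeFn_absRpow (1 / r) (x + y), coeFn_absRpow (1 / r) x,
    coeFn_absRpow (1 / r) y, AEEqFun.coeFn_add x y,
    AEEqFun.coeFn_smul ((2 : ℝ) ^ (1 / r)) (absRpow (1 / r) x + absRpow (1 / r) y),
    AEEqFun.coeFn_add (absRpow (1 / r) x) (absRpow (1 / r) y)] with ω h1 h2 h3 h4 h5 h6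
  have hr' : 0 < 1 / r := by positivity
  rw [h1, h5, Pi.smul_apply, h6, Pi.add_apply, h2, h3, h4, Pi.add_apply, smul_eq_mul]
  rw [abs_of_nonneg (Real.rpow_nonneg (abs_nonneg (x ω + y ω)) (1 / r)),
    abs_of_nonneg (a := (2 : ℝ) ^ (1 / r) * (|x ω| ^ (1 / r) + |y ω| ^ (1 / r))) (by positivity)]
  exact (Real.rpow_le_rpow (abs_nonneg _) (abs_add_le _ _) hr'.le).trans
    (rpow_add_le_aux hr' (abs_nonneg _) (abs_nonneg _))

theorem absRpow_smul {r : ℝ} (a : ℝ) (x : Ω →ₘ[μ] ℝ) :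
    absRpow r (a • x) = |a| ^ r • absRpow r x := by
  apply AEEqFun.ext
  filter_upwards [coeFn_absRpow r (a • x), coeFn_absRpow r x, AEEqFun.coeFn_smul a x,
    AEEqFun.coeFn_smul (|a| ^ r) (absRpow r x)] with ω h1 h2 h3 h4
  rw [h1, h4, h3, Pi.smul_apply, Pi.smul_apply, h2, smul_eq_mul, smul_eq_mul, abs_mul,
    Real.mul_rpow (abs_nonneg _) (abs_nonneg _)]

theorem absRpow_zero {r : ℝ} (hr : 0 < r) : absRpow r (0 : Ω →ₘ[μ] ℝ) = 0 := by
  have := absRpow_smul (r := r) 0 (0 : Ω →ₘ[μ] ℝ)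
  simpa [Real.zero_rpow hr.ne'] using this

theorem absRpow_eq_zero {r : ℝ} (hr : 0 < r) {x : Ω →ₘ[μ] ℝ} : absRpow r x = 0 ↔ x = 0 := by
  refine ⟨fun h => ?_, fun h => h ▸ absRpow_zero hr⟩
  apply AEEqFun.ext
  have h0 := coeFn_absRpow r x
  rw [h] at h0
  filter_upwards [h0, AEEqFun.coeFn_zero (α := Ω) (μ := μ) (β := ℝ)] with ω h1 h2
  rw [h2] at h1 ⊢
  have h3 : |x ω| ^ r = 0 := by simpa using h1.symm
  simpa using (Real.rpow_eq_zero (abs_nonneg _) hr.ne').1 h3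

theorem absRpow_nonneg (r : ℝ) (x : Ω →ₘ[μ] ℝ) : 0 ≤ absRpow r x := by
  rw [← AEEqFun.coeFn_le]
  filter_upwards [coeFn_absRpow r x, AEEqFun.coeFn_zero (α := Ω) (μ := μ) (β := ℝ)] with ω h1 h2
  rw [h1, h2]
  exact Real.rpow_nonneg (abs_nonneg _) r

theorem absRpow_absRpow (r s : ℝ) (x : Ω →ₘ[μ] ℝ) :
    absRpow s (absRpow r x) = absRpow (r * s) x := by
  apply AEEqFun.ext
  filter_upwards [coeFn_absRpow s (absRpow r x), coeFn_absRpow r x,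
    coeFn_absRpow (r * s) x] with ω h1 h2 h3
  rw [h1, h2, h3, abs_of_nonneg (Real.rpow_nonneg (abs_nonneg (x ω)) r),
    ← Real.rpow_mul (abs_nonneg _)]

/-- The `r`-th power `X^r = {x ∈ L₀(μ) : |x|^(1/r) ∈ X}` with the quasi norm
`‖x‖ = ‖ |x|^(1/r) ‖_X ^ r`. -/
noncomputable def power (X : QuasiKotheSpace μ) (r : ℝ) (hr : 0 < r) : QuasiKotheSpace μ where
  carrier :=
    { carrier := {x | absRpow (1 / r) x ∈ X.carrier}
      add_mem' := fun hx hy => (X.power_add_aux hr hx hy).1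
      zero_mem' := by
        change absRpow (1 / r) 0 ∈ X.carrier
        rw [absRpow_zero (by positivity)]
        exact X.carrier.zero_mem
      smul_mem' := fun a x hx => by
        change absRpow (1 / r) (a • x) ∈ X.carrier
        rw [absRpow_smul]
        exact X.carrier.smul_mem _ hx }
  qnorm x := X.qnorm (absRpow (1 / r) x) ^ r
  qnorm_nonneg x hx := Real.rpow_nonneg (X.qnorm_nonneg _ hx) r
  qnorm_eq_zero x hx := by
    rw [Real.rpow_eq_zero (X.qnorm_nonneg _ hx) hr.ne', X.qnorm_eq_zero _ hx,
      absRpow_eq_zero (by positivity)]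
  qnorm_smul a x hx := by
    rw [absRpow_smul, X.qnorm_smul _ _ hx, Real.mul_rpow (abs_nonneg _) (X.qnorm_nonneg _ hx),
      abs_of_nonneg (Real.rpow_nonneg (abs_nonneg a) _), ← Real.rpow_mul (abs_nonneg _),
      one_div_mul_cancel hr.ne', Real.rpow_one]
  qnorm_add := by
    obtain ⟨C, hC0, hC⟩ := X.qnorm_add
    refine ⟨((2 : ℝ) ^ (1 / r) * C) ^ r * 2 ^ r, by positivity, fun x hx y hy => ?_⟩
    have h1 := X.power_add_aux hr hx hy
    have hx0 := X.qnorm_nonneg _ hx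
    have hy0 := X.qnorm_nonneg _ hy
    rw [X.qnorm_smul _ _ (X.carrier.add_mem hx hy), abs_of_nonneg (by positivity)] at h1
    have h2 : X.qnorm (absRpow (1 / r) (x + y)) ≤
        ((2 : ℝ) ^ (1 / r) * C) * (X.qnorm (absRpow (1 / r) x) + X.qnorm (absRpow (1 / r) y)) := by
      rw [mul_assoc]
      exact h1.2.trans (mul_le_mul_of_nonneg_left (hC _ hx _ hy) (by positivity))
    refine (Real.rpow_le_rpow (X.qnorm_nonneg _ h1.1) h2 hr.le).trans ?_
    rw [Real.mul_rpow (by positivity) (by positivity), mul_assoc]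
    exact mul_le_mul_of_nonneg_left (rpow_add_le_aux hr hx0 hy0) (by positivity)
  solid x y hy h := by
    have h1 := X.solid (absRpow (1 / r) x) (absRpow (1 / r) y) hy (by
      filter_upwards [h, coeFn_absRpow (1 / r) x, coeFn_absRpow (1 / r) y] with ω h1 h2 h3
      rw [h2, h3, abs_of_nonneg (Real.rpow_nonneg (abs_nonneg (x ω)) (1 / r)),
        abs_of_nonneg (Real.rpow_nonneg (abs_nonneg (y ω)) (1 / r))]
      exact Real.rpow_le_rpow (abs_nonneg _) h1 (by positivity))
    exact ⟨h1.1, Real.rpow_le_rpow (X.qnorm_nonneg _ h1.1) h1.2 hr.le⟩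
  convex := by
    obtain ⟨t, ht, h⟩ := X.convex
    refine ⟨t / r, by positivity, fun x hx y hy => ?_⟩
    have h1 := h _ hx _ hy
    have hx0 := X.qnorm_nonneg _ hx
    have hy0 := X.qnorm_nonneg _ hy
    have e1 : 1 / (t / r) * (1 / r) = 1 / t := by field_simp
    have e2 : 1 / r * t = t / r := by ring
    have e3 : r * (t / r) = t := by field_simp
    have e4 : 1 / t * r = 1 / (t / r) := by field_simp
    have hm : absRpow (1 / t) (absRpow (t / r) x + absRpow (t / r) y) ∈ X.carrier := by
      have hxt : absRpow (1 / t) (absRpow (t / r) x) ∈ X.carrier := by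
        rw [← e2, ← absRpow_absRpow]
        exact X.absRpow_mem ht hx
      have hyt : absRpow (1 / t) (absRpow (t / r) y) ∈ X.carrier := by
        rw [← e2, ← absRpow_absRpow]
        exact X.absRpow_mem ht hy
      exact (X.power_add_aux ht hxt hyt).1
    rw [absRpow_absRpow, absRpow_absRpow, e2] at h1
    rw [absRpow_absRpow, e1, ← Real.rpow_mul hx0, ← Real.rpow_mul hy0, e3]
    refine (Real.rpow_le_rpow (X.qnorm_nonneg _ hm) h1 hr.le).trans ?_
    rw [← Real.rpow_mul (by positivity), e4]
  full_support S hS h := by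
    refine X.full_support S hS fun x hx => ?_
    filter_upwards [h (absRpow r x) (X.absRpow_mem hr hx), coeFn_absRpow r x] with ω h1 h2 hω
    have h3 := h1 hω
    rw [h2] at h3
    exact abs_eq_zero.1 ((Real.rpow_eq_zero (abs_nonneg _) hr.ne').1 h3)
  fatou x y hy hx h0 hm ht := by
    have hr' : 0 < 1 / r := by positivity
    have hae : ∀ᵐ ω ∂μ, ∀ n, absRpow (1 / r) (x n) ω = |x n ω| ^ (1 / r) :=
      ae_all_iff.2 fun n => coeFn_absRpow (1 / r) (x n)
    have hnn : ∀ᵐ ω ∂μ, ∀ n, 0 ≤ x n ω := ae_all_iff.2 fun n => by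
      filter_upwards [AEEqFun.coeFn_le.2 (h0 n),
        AEEqFun.coeFn_zero (α := Ω) (μ := μ) (β := ℝ)] with ω h1 h2
      simpa [h2] using h1
    have key := X.fatou (fun n => absRpow (1 / r) (x n)) (absRpow (1 / r) y) hy hx
      (fun n => absRpow_nonneg _ _)
      (by
        filter_upwards [hae, hnn, hm] with ω h1 h2 h3 m n hmn
        simp only [h1]
        rw [abs_of_nonneg (h2 m), abs_of_nonneg (h2 n)]
        exact Real.rpow_le_rpow (h2 m) (h3 hmn) hr'.le)
      (by
        filter_upwards [hae, ht, coeFn_absRpow (1 / r) y] with ω h1 h2 h3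
        simp only [h1, h3]
        exact h2.abs.rpow_const (Or.inr hr'.le))
    exact key.rpow_const (Or.inr hr.le)

/-- For `x ∈ X`, the element `|x|^r` of `X^r`. -/
noncomputable def toPower (X : QuasiKotheSpace μ) (r : ℝ) (hr : 0 < r) (x : X.carrier) :
    (X.power r hr).carrier :=
  ⟨absRpow r (x : Ω →ₘ[μ] ℝ), X.absRpow_mem hr x.2⟩

end QuasiKotheSpace

end Kothe

/-! Put `θᵢ = t / rᵢ`, so `θ₁ + θ₂ = 1`, and let `Nᵢ` be the quasi norm of `Xᵢ^rᵢ`. The hypothesis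
raised to the power `t` bounds `∑ |u(xₖ, yₖ)|^t` by `N₁(f)^θ₁ N₂(g)^θ₂`, with `f = ∑ |φ₁(xₖ)|^r₁`
and `g = ∑ |φ₂(yₖ)|^r₂`. Weighted AM-GM bounds this by `θ₁ N₁(f) + θ₂ N₂(g)`, and `rᵢ`-convexity
bounds `Nᵢ(h)` by `M^rᵢ ∑ ‖zⱼ‖^rᵢ` whenever `0 ≤ h ≤ ∑ |zⱼ|^rᵢ`.

These estimates say that a convex cone in `(X₁^r₁ × X₂^r₂) × ℝ` has no point of positive height
above `0`. It is the sum of `formCone`, which records `u`, and two copies of `boundCone`, which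
record order and norm. The M. Riesz extension theorem (`exists_linearMap_ge_of_pointedCone`) puts a
linear functional above the cone. Its two components are, up to the weights, positive functionals
with the required bounds, and `|u|^t ≤ θ₁ Φ₁ + θ₂ Φ₂` (`exists_functionals_add`). Rescaling `x` and
`y` independently turns this sum into the product `Φ₁^θ₁ Φ₂^θ₂`
(`le_rpow_mul_rpow_of_forall_scale`).

If `Xᵢ` is `σ`-order continuous, so is its power. A bounded positive functional on the power is then
countably additive on indicators, hence is integration against a measure `ν ≪ μ`, and Radon-Nikodym
gives the density (`exists_memKotheDual_eq_integral`). The functionals already found are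
represented; no new choice is made. -/

namespace Kothe

variable {Ω : Type*} [MeasurableSpace Ω] {μ : Measure Ω}

/-! ### Exhaustion by countably many sets -/

/-- A family of sets contains a sequence whose union covers, up to null sets, every measurable
member of the family. -/
theorem exists_seq_forall_measure_diff_iUnion_eq_zero [SigmaFinite μ] {𝒜 : Set (Set Ω)}
    (h𝒜 : 𝒜.Nonempty) (hm : ∀ A ∈ 𝒜, MeasurableSet A) :
    ∃ B : ℕ → Set Ω, (∀ n, B n ∈ 𝒜) ∧ ∀ A ∈ 𝒜, μ (A \ ⋃ n, B n) = 0 := by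
  -- `μ.toFinite` is finite with the same null sets as `μ`, so a union of maximal measure cannot
  -- grow by a set of positive measure.
  set T : Set ENNReal :=
    Set.image (fun B : ℕ → Set Ω => μ.toFinite (⋃ n, B n)) {B | ∀ n, B n ∈ 𝒜}
  obtain ⟨A₀, hA₀⟩ := h𝒜
  have hT : T.Nonempty := ⟨_, fun _ => A₀, fun _ => hA₀, rfl⟩
  obtain ⟨v, -, hv, hvT⟩ := exists_seq_tendsto_sSup hT (OrderTop.bddAbove T)
  choose B hB hBv using hvT
  -- The union of all sequences in a maximizing sequence attains the supremum; pairing lists them as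
  -- one sequence.
  refine ⟨fun n => B n.unpair.1 n.unpair.2, fun n => hB _ _, fun A hA => ?_⟩
  set S := ⋃ n : ℕ, B n.unpair.1 n.unpair.2 with hS
  have hSm : MeasurableSet S := .iUnion fun n => hm _ (hB _ _)
  have h1 : sSup T ≤ μ.toFinite S := by
    refine le_of_tendsto' hv fun k => ?_
    rw [← hBv k]
    refine measure_mono (Set.iUnion_subset fun j => ?_)
    have := Set.subset_iUnion (fun n : ℕ => B n.unpair.1 n.unpair.2) (Nat.pair k j)
    simpa using this
  have h2 : μ.toFinite (A ∪ S) ≤ sSup T := by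
    -- Putting `A` at index `0` makes `A ∪ S` a competitor.
    refine le_sSup ⟨fun n => Nat.casesOn n A fun m => B m.unpair.1 m.unpair.2, ?_, ?_⟩
    · rintro (_ | n)
      exacts [hA, hB _ _]
    · change μ.toFinite _ = _
      congr 1
      ext ω
      simp only [Set.mem_iUnion, Set.mem_union, hS]
      constructor
      · rintro ⟨_ | n, hn⟩
        exacts [Or.inl hn, Or.inr ⟨n, hn⟩]
      · rintro (h | ⟨n, hn⟩)
        exacts [⟨0, h⟩, ⟨n + 1, hn⟩]
  apply absolutelyContinuous_toFinite μ
  have h3 : μ.toFinite ((A ∪ S) \ S) = 0 := by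
    rw [measure_sdiff Set.subset_union_right hSm.nullMeasurableSet (measure_ne_top _ _)]
    exact tsub_eq_zero_of_le (h2.trans h1)
  rwa [Set.union_sdiff_right] at h3

/-! ### Functionals evaluated on functions instead of classes -/

namespace QuasiKotheSpace

variable (Y : QuasiKotheSpace μ)

/-- The function `f` represents an element of `Y`. -/
def MemFun (f : Ω → ℝ) : Prop := ∃ x : Y.carrier, (x : Ω →ₘ[μ] ℝ) =ᵐ[μ] f

open Classical in
/-- The value of a linear functional on the class of a function, and `0` on functions which do not
represent an element of `Y`. -/
noncomputable def evalFun (Φ : Y.carrier →ₗ[ℝ] ℝ) (f : Ω → ℝ) : ℝ :=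
  if h : Y.MemFun f then Φ h.choose else 0

variable {Y} {Φ : Y.carrier →ₗ[ℝ] ℝ} {f g : Ω → ℝ}

theorem evalFun_eq {x : Y.carrier} (h : (x : Ω →ₘ[μ] ℝ) =ᵐ[μ] f) : Y.evalFun Φ f = Φ x := by
  have hf : Y.MemFun f := ⟨x, h⟩
  rw [evalFun, dif_pos hf]
  congr 1
  exact Subtype.ext (AEEqFun.ext (hf.choose_spec.trans h.symm))

theorem memFun_coe (x : Y.carrier) : Y.MemFun (x : Ω →ₘ[μ] ℝ) := ⟨x, .rfl⟩

theorem MemFun.congr (hf : Y.MemFun f) (h : f =ᵐ[μ] g) : Y.MemFun g :=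
  let ⟨x, hx⟩ := hf; ⟨x, hx.trans h⟩

theorem evalFun_congr (h : f =ᵐ[μ] g) : Y.evalFun Φ f = Y.evalFun Φ g := by
  by_cases hf : Y.MemFun f
  · obtain ⟨x, hx⟩ := hf
    rw [evalFun_eq hx, evalFun_eq (hx.trans h)]
  · rw [evalFun, evalFun, dif_neg hf, dif_neg fun hg => hf (hg.congr h.symm)]

theorem MemFun.add (hf : Y.MemFun f) (hg : Y.MemFun g) : Y.MemFun (f + g) := by
  obtain ⟨x, hx⟩ := hf
  obtain ⟨y, hy⟩ := hg
  exact ⟨x + y, (AEEqFun.coeFn_add _ _).trans (hx.add hy)⟩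

theorem evalFun_add (hf : Y.MemFun f) (hg : Y.MemFun g) :
    Y.evalFun Φ (f + g) = Y.evalFun Φ f + Y.evalFun Φ g := by
  obtain ⟨x, hx⟩ := hf
  obtain ⟨y, hy⟩ := hg
  have h : ((x + y : Y.carrier) : Ω →ₘ[μ] ℝ) =ᵐ[μ] f + g :=
    (AEEqFun.coeFn_add _ _).trans (hx.add hy)
  rw [evalFun_eq h, evalFun_eq hx, evalFun_eq hy, map_add]

theorem MemFun.smul (hf : Y.MemFun f) (c : ℝ) : Y.MemFun (c • f) := by
  obtain ⟨x, hx⟩ := hf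
  exact ⟨c • x, (AEEqFun.coeFn_smul _ _).trans (hx.const_smul c)⟩

theorem evalFun_smul (hf : Y.MemFun f) (c : ℝ) :
    Y.evalFun Φ (c • f) = c * Y.evalFun Φ f := by
  obtain ⟨x, hx⟩ := hf
  have h : ((c • x : Y.carrier) : Ω →ₘ[μ] ℝ) =ᵐ[μ] c • f :=
    (AEEqFun.coeFn_smul _ _).trans (hx.const_smul c)
  rw [evalFun_eq h, evalFun_eq hx, map_smul, smul_eq_mul]

theorem MemFun.sub (hf : Y.MemFun f) (hg : Y.MemFun g) : Y.MemFun (f - g) := by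
  have := hf.add (hg.smul (-1))
  simpa [sub_eq_add_neg] using this

theorem evalFun_sub (hf : Y.MemFun f) (hg : Y.MemFun g) :
    Y.evalFun Φ (f - g) = Y.evalFun Φ f - Y.evalFun Φ g := by
  have := evalFun_add (Φ := Φ) (hf.sub hg) hg
  rw [sub_add_cancel] at this
  linarith

theorem memFun_zero : Y.MemFun 0 := ⟨0, AEEqFun.coeFn_zero⟩

theorem evalFun_zero : Y.evalFun Φ 0 = 0 := by
  rw [evalFun_eq (x := 0) AEEqFun.coeFn_zero, map_zero]

theorem MemFun.of_abs_le (hg : Y.MemFun g) (hf : AEStronglyMeasurable f μ)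
    (h : ∀ᵐ ω ∂μ, |f ω| ≤ |g ω|) : Y.MemFun f := by
  obtain ⟨y, hy⟩ := hg
  refine ⟨⟨AEEqFun.mk f hf, (Y.solid _ y y.2 ?_).1⟩, AEEqFun.coeFn_mk f hf⟩
  filter_upwards [AEEqFun.coeFn_mk f hf, hy, h] with ω h1 h2 h3
  rwa [h1, h2]

theorem coe_nonneg_iff {x : Ω →ₘ[μ] ℝ} : 0 ≤ x ↔ ∀ᵐ ω ∂μ, 0 ≤ x ω := by
  rw [← AEEqFun.coeFn_le]
  constructor <;> intro h
  all_goals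
    filter_upwards [h, AEEqFun.coeFn_zero (α := Ω) (μ := μ) (β := ℝ)] with ω h1 h2
    simpa [h2] using h1

/-- The default value `0` is nonnegative, so membership of `f` is not needed. -/
theorem evalFun_nonneg (hΦ : ∀ f : Y.carrier, 0 ≤ (f : Ω →ₘ[μ] ℝ) → 0 ≤ Φ f)
    (h : ∀ᵐ ω ∂μ, 0 ≤ f ω) : 0 ≤ Y.evalFun Φ f := by
  by_cases hf : Y.MemFun f
  · obtain ⟨x, hx⟩ := hf
    rw [evalFun_eq hx]
    refine hΦ x (coe_nonneg_iff.2 ?_)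
    filter_upwards [hx, h] with ω h1 h2
    rwa [h1]
  · rw [evalFun, dif_neg hf]

/-! ### Order continuity and countable additivity -/

/-- The differences `f - F n` decrease to `0`, so their quasi norms tend to `0`, and `0 ≤ Φ ≤ C ‖·‖`
on positive elements squeezes their values. -/
theorem tendsto_evalFun (hY : Y.SigmaOrderContinuous)
    (hΦ : ∀ f : Y.carrier, 0 ≤ (f : Ω →ₘ[μ] ℝ) → 0 ≤ Φ f) {C : ℝ}
    (hC : ∀ f : Y.carrier, 0 ≤ (f : Ω →ₘ[μ] ℝ) → Φ f ≤ C * Y.qnorm f)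
    {F : ℕ → Ω → ℝ} (hF : ∀ n, Y.MemFun (F n)) (hf : Y.MemFun f)
    (hmono : ∀ᵐ ω ∂μ, Monotone fun n => F n ω)
    (hlim : ∀ᵐ ω ∂μ, Tendsto (fun n => F n ω) atTop (𝓝 (f ω))) :
    Tendsto (fun n => Y.evalFun Φ (F n)) atTop (𝓝 (Y.evalFun Φ f)) := by
  choose x hx using fun n => hf.sub (hF n)
  have hx' : ∀ᵐ ω ∂μ, ∀ n, (x n : Ω →ₘ[μ] ℝ) ω = f ω - F n ω := ae_all_iff.2 hx
  have h0 : ∀ n, 0 ≤ (x n : Ω →ₘ[μ] ℝ) := fun n => by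
    rw [coe_nonneg_iff]
    filter_upwards [hx', hmono, hlim] with ω h1 h2 h3
    rw [h1, sub_nonneg]
    exact h2.ge_of_tendsto h3 n
  have h1 : Tendsto (fun n => Y.qnorm (x n)) atTop (𝓝 0) := by
    refine hY _ (fun n => (x n).2) h0 ?_ ?_
    · filter_upwards [hx', hmono] with ω h1 h2 m n hmn
      simp only [h1]
      exact sub_le_sub_left (h2 hmn) _
    · filter_upwards [hx', hlim] with ω h1 h2
      simp only [h1]
      simpa using h2.const_sub (f ω)
  have h2 : Tendsto (fun n => Φ (x n)) atTop (𝓝 0) :=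
    squeeze_zero (fun n => hΦ _ (h0 n)) (fun n => hC _ (h0 n)) (by simpa using h1.const_mul C)
  have h3 : ∀ n, Y.evalFun Φ (F n) = Y.evalFun Φ f - Φ (x n) := fun n => by
    rw [← evalFun_eq (hx n), evalFun_sub hf (hF n)]
    ring
  simp only [h3]
  simpa using h2.const_sub (Y.evalFun Φ f)

/-- By disjointness the partial sums of the indicators increase pointwise to the indicator of the
union, so `tendsto_evalFun` applies; solidity puts each piece in `Y`. -/
theorem tsum_evalFun_indicator (hY : Y.SigmaOrderContinuous)
    (hΦ : ∀ f : Y.carrier, 0 ≤ (f : Ω →ₘ[μ] ℝ) → 0 ≤ Φ f) {C : ℝ}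
    (hC : ∀ f : Y.carrier, 0 ≤ (f : Ω →ₘ[μ] ℝ) → Φ f ≤ C * Y.qnorm f)
    {A : ℕ → Set Ω} (hA : ∀ n, MeasurableSet (A n)) (hd : Pairwise (Function.onFun Disjoint A))
    (hU : Y.MemFun ((⋃ n, A n).indicator 1)) :
    ENNReal.ofReal (Y.evalFun Φ ((⋃ n, A n).indicator 1)) =
      ∑' n, ENNReal.ofReal (Y.evalFun Φ ((A n).indicator 1)) := by
  have hmem : ∀ S : Set Ω, MeasurableSet S → S ⊆ ⋃ n, A n → Y.MemFun (S.indicator 1) :=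
    fun S hS hSA => hU.of_abs_le
      ((measurable_one.indicator hS).aestronglyMeasurable) (.of_forall fun ω => by
        rw [abs_of_nonneg (Set.indicator_nonneg (by simp) _),
          abs_of_nonneg (Set.indicator_nonneg (by simp) _)]
        exact Set.indicator_le_indicator_of_subset hSA (by simp) ω)
  have hmn : ∀ n, Y.MemFun ((A n).indicator 1) := fun n => hmem _ (hA n) (Set.subset_iUnion A n)
  have hpos : ∀ n, 0 ≤ Y.evalFun Φ ((A n).indicator 1) := fun n =>
    evalFun_nonneg hΦ (.of_forall (Set.indicator_nonneg (by simp)))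
  have hsum : ∀ n, Y.MemFun (∑ i ∈ Finset.range n, (A i).indicator 1) ∧
      Y.evalFun Φ (∑ i ∈ Finset.range n, (A i).indicator 1) =
        ∑ i ∈ Finset.range n, Y.evalFun Φ ((A i).indicator 1) := by
    intro n
    induction n with
    | zero => exact ⟨memFun_zero, evalFun_zero⟩
    | succ n ih =>
      rw [Finset.sum_range_succ, Finset.sum_range_succ, ← ih.2]
      exact ⟨ih.1.add (hmn n), evalFun_add ih.1 (hmn n)⟩
  have hs : HasSum (fun n => Y.evalFun Φ ((A n).indicator 1))
      (Y.evalFun Φ ((⋃ n, A n).indicator 1)) := by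
    rw [hasSum_iff_tendsto_nat_of_nonneg hpos]
    simp only [← (hsum _).2]
    refine tendsto_evalFun hY hΦ hC (fun n => (hsum n).1) hU ?_ ?_
    · refine .of_forall fun ω => monotone_nat_of_le_succ fun n => ?_
      rw [Finset.sum_range_succ]
      simp only [Pi.add_apply, le_add_iff_nonneg_right]
      exact Set.indicator_nonneg (by simp) ω
    · refine .of_forall fun ω => ?_
      simp only [Finset.sum_apply]
      refine HasSum.tendsto_sum_nat ?_
      by_cases hω : ω ∈ ⋃ n, A n
      · obtain ⟨n, hn⟩ := Set.mem_iUnion.1 hω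
        rw [Set.indicator_of_mem hω, ← Set.indicator_of_mem hn (1 : Ω → ℝ)]
        refine hasSum_single n fun m hmn => Set.indicator_of_notMem (fun hm => ?_) _
        exact Set.disjoint_left.1 (hd hmn) hm hn
      · rw [Set.indicator_of_notMem hω]
        have : ∀ n, (A n).indicator (1 : Ω → ℝ) ω = 0 := fun n =>
          Set.indicator_of_notMem (fun h => hω (Set.mem_iUnion.2 ⟨n, h⟩)) _
        simpa only [this] using hasSum_zero
  rw [← hs.tsum_eq, ENNReal.ofReal_tsum_of_nonneg hpos hs.summable]

/-! ### Integral representation of positive functionals -/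

/-- A quasi Köthe function space contains the indicator functions of the members of a measurable
partition of the underlying space, up to a null set. -/
theorem exists_disjoint_cover [SigmaFinite μ] (Y : QuasiKotheSpace μ) :
    ∃ B : ℕ → Set Ω, (∀ n, MeasurableSet (B n)) ∧ Pairwise (Function.onFun Disjoint B) ∧
      (∀ n, Y.MemFun ((B n).indicator 1)) ∧ μ (⋃ n, B n)ᶜ = 0 := by
  obtain ⟨B, hB, hcov⟩ := exists_seq_forall_measure_diff_iUnion_eq_zero (μ := μ)
    (𝒜 := {A | MeasurableSet A ∧ Y.MemFun (A.indicator 1)})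
    ⟨∅, .empty, by
      rw [Set.indicator_empty]
      exact memFun_zero⟩ fun A hA => hA.1
  have hdm : ∀ n, MeasurableSet (disjointed B n) := fun n =>
    .disjointed (fun i => (hB i).1) n
  refine ⟨disjointed B, hdm, disjoint_disjointed B, fun n => ?_, ?_⟩
  · refine (hB n).2.of_abs_le ((measurable_one.indicator (hdm n)).aestronglyMeasurable)
      (.of_forall fun ω => ?_)
    rw [abs_of_nonneg (Set.indicator_nonneg (by simp) _),
      abs_of_nonneg (Set.indicator_nonneg (by simp) _)]
    exact Set.indicator_le_indicator_of_subset (disjointed_subset B n) (by simp) ω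
  rw [iUnion_disjointed]
  refine Y.full_support _ (.iUnion fun n => (hB n).1) fun x hx => ?_
  -- On this level set the indicator is at most `k |x|`, so it lies in `Y` and the set is covered up
  -- to a null set. As `k` varies these sets exhaust the support of `x`.
  have hAm : ∀ k : ℕ, MeasurableSet {ω | 1 ≤ (k : ℝ) * |x ω|} := fun k =>
    measurableSet_le measurable_const (x.measurable.abs.const_mul _)
  have hA : ∀ k : ℕ, μ ({ω | 1 ≤ (k : ℝ) * |x ω|} \ ⋃ n, B n) = 0 := fun k => by
    refine hcov _ ⟨hAm k, ((memFun_coe ⟨x, hx⟩).smul k).of_abs_le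
      ((measurable_one.indicator (hAm k)).aestronglyMeasurable) (.of_forall fun ω => ?_)⟩
    by_cases hω : ω ∈ {ω | 1 ≤ (k : ℝ) * |x ω|}
    · rw [Set.indicator_of_mem hω]
      simpa [abs_mul] using hω
    · rw [Set.indicator_of_notMem hω, abs_zero]
      exact abs_nonneg _
  have hA' := measure_iUnion_null hA
  rw [measure_eq_zero_iff_ae_notMem] at hA'
  filter_upwards [hA'] with ω h1 h2
  by_contra h3
  obtain ⟨k, hk⟩ := exists_nat_ge (|x ω|)⁻¹
  refine h1 (Set.mem_iUnion.2 ⟨k, ?_, h2⟩)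
  have h4 : 0 < |x ω| := abs_pos.2 h3
  calc (1 : ℝ) = |x ω|⁻¹ * |x ω| := (inv_mul_cancel₀ h4.ne').symm
    _ ≤ k * |x ω| := by gcongr

/-- A positive functional on a `σ`-order continuous space is integration against a measure. -/
theorem exists_measure_lintegral_eq [SigmaFinite μ] (hY : Y.SigmaOrderContinuous)
    (hΦ : ∀ f : Y.carrier, 0 ≤ (f : Ω →ₘ[μ] ℝ) → 0 ≤ Φ f) {C : ℝ}
    (hC : ∀ f : Y.carrier, 0 ≤ (f : Ω →ₘ[μ] ℝ) → Φ f ≤ C * Y.qnorm f) :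
    ∃ ν : Measure Ω, SFinite ν ∧ ν ≪ μ ∧ ∀ f : Ω → ENNReal, Measurable f → (∀ ω, f ω ≠ ⊤) →
      Y.MemFun (fun ω => (f ω).toReal) →
      ∫⁻ ω, f ω ∂ν = ENNReal.ofReal (Y.evalFun Φ fun ω => (f ω).toReal) := by
  obtain ⟨B, hBm, hBd, hBmem, hB⟩ := Y.exists_disjoint_cover
  have hmem : ∀ S n, MeasurableSet S → Y.MemFun ((S ∩ B n).indicator 1) := fun S n hS =>
    (hBmem n).of_abs_le ((measurable_one.indicator (hS.inter (hBm n))).aestronglyMeasurable)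
      (.of_forall fun ω => by
        rw [abs_of_nonneg (Set.indicator_nonneg (by simp) _),
          abs_of_nonneg (Set.indicator_nonneg (by simp) _)]
        exact Set.indicator_le_indicator_of_subset Set.inter_subset_right (by simp) ω)
  -- The indicator of `S` need not lie in `Y`, but that of `S ∩ B n` does. Each `ν n` is finite, so
  -- their sum is s-finite, as Radon-Nikodym requires.
  let ν : ℕ → Measure Ω := fun n => Measure.ofMeasurable
    (fun S _ => ENNReal.ofReal (Y.evalFun Φ ((S ∩ B n).indicator 1)))
    (by simp [show (fun _ : Ω => (0 : ℝ)) = 0 from rfl, evalFun_zero])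
    (fun A hA hd => by
      rw [Set.iUnion_inter]
      refine tsum_evalFun_indicator hY hΦ hC (fun i => (hA i).inter (hBm n)) (fun i j hij => ?_) ?_
      · exact (hd hij).mono Set.inter_subset_left Set.inter_subset_left
      · rw [← Set.iUnion_inter]
        exact hmem _ n (.iUnion hA))
  have hν : ∀ n S, MeasurableSet S →
      ν n S = ENNReal.ofReal (Y.evalFun Φ ((S ∩ B n).indicator 1)) := fun n S hS =>
    Measure.ofMeasurable_apply S hS
  have hfin : ∀ n, IsFiniteMeasure (ν n) := fun n => ⟨by
    rw [hν n _ .univ]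
    exact ENNReal.ofReal_lt_top⟩
  have hset : ∀ S, MeasurableSet S → Y.MemFun (S.indicator 1) →
      Measure.sum ν S = ENNReal.ofReal (Y.evalFun Φ (S.indicator 1)) := fun S hS hSmem => by
    have hae : S.indicator (1 : Ω → ℝ) =ᵐ[μ] (⋃ n, S ∩ B n).indicator 1 := by
      rw [← Set.inter_iUnion]
      rw [measure_eq_zero_iff_ae_notMem] at hB
      filter_upwards [hB] with ω hω
      rw [Set.notMem_compl_iff] at hω
      by_cases hS : ω ∈ S
      · rw [Set.indicator_of_mem hS, Set.indicator_of_mem (Set.mem_inter hS hω)]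
      · rw [Set.indicator_of_notMem hS, Set.indicator_of_notMem fun h => hS h.1]
    rw [Measure.sum_apply _ hS, evalFun_congr hae,
      tsum_evalFun_indicator hY hΦ hC (fun n => hS.inter (hBm n)) (fun i j hij =>
        (hBd hij).mono Set.inter_subset_right Set.inter_subset_right) (hSmem.congr hae)]
    exact tsum_congr fun n => hν n S hS
  refine ⟨Measure.sum ν, inferInstance, ?_, ?_⟩
  · refine Measure.AbsolutelyContinuous.mk fun S hS h0 => ?_
    have hae : S.indicator (1 : Ω → ℝ) =ᵐ[μ] 0 := indicator_meas_zero h0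
    rw [hset S hS (memFun_zero.congr hae.symm), evalFun_congr hae, evalFun_zero,
      ENNReal.ofReal_zero]
  intro f hf
  -- Finiteness and membership are carried in the motive, because `toReal` and `evalFun` would
  -- otherwise return default values.
  refine Measurable.ennreal_induction (motive := fun f => (∀ ω, f ω ≠ ⊤) →
    Y.MemFun (fun ω => (f ω).toReal) → ∫⁻ ω, f ω ∂Measure.sum ν =
      ENNReal.ofReal (Y.evalFun Φ fun ω => (f ω).toReal)) ?_ ?_ ?_ hf
  · intro c S hS hfin hmem
    rw [lintegral_indicator_const hS]
    have hfun : (fun ω => (S.indicator (fun _ => c) ω).toReal) = c.toReal • S.indicator 1 := by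
      ext ω
      by_cases hω : ω ∈ S <;> simp [hω]
    -- Finiteness of `c` needs a point of `S`, and membership of the indicator of `S` needs `c ≠ 0`;
    -- the degenerate cases are separate.
    rcases S.eq_empty_or_nonempty with rfl | ⟨ω, hω⟩
    · simp [show (fun _ : Ω => (0 : ℝ)) = 0 from rfl, evalFun_zero]
    have hc : c ≠ ⊤ := by simpa [hω] using hfin ω
    rw [hfun] at hmem ⊢
    rcases eq_or_ne c 0 with rfl | hc0
    · simp [evalFun_zero]
    have hc1 : c.toReal ≠ 0 := ENNReal.toReal_ne_zero.2 ⟨hc0, hc⟩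
    have hSm : Y.MemFun (S.indicator 1) := by
      have := hmem.smul c.toReal⁻¹
      rwa [smul_smul, inv_mul_cancel₀ hc1, one_smul] at this
    rw [evalFun_smul hSm, ENNReal.ofReal_mul ENNReal.toReal_nonneg, ENNReal.ofReal_toReal hc,
      hset S hS hSm]
  · intro f g hd hf hg ihf ihg hfin hmem
    have hf1 : ∀ ω, f ω ≠ ⊤ := fun ω h => hfin ω (by simp [h])
    have hg1 : ∀ ω, g ω ≠ ⊤ := fun ω h => hfin ω (by simp [h])
    have hsum : (fun ω => ((f + g) ω).toReal) = (fun ω => (f ω).toReal) + fun ω => (g ω).toReal := by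
      ext ω
      exact ENNReal.toReal_add (hf1 ω) (hg1 ω)
    rw [hsum] at hmem ⊢
    have hfm : Y.MemFun fun ω => (f ω).toReal := hmem.of_abs_le
      hf.ennreal_toReal.aestronglyMeasurable (.of_forall fun ω => by
        simp only [Pi.add_apply]
        rw [abs_of_nonneg ENNReal.toReal_nonneg, abs_of_nonneg (by positivity)]
        exact le_add_of_nonneg_right ENNReal.toReal_nonneg)
    have hgm : Y.MemFun fun ω => (g ω).toReal := hmem.of_abs_le
      hg.ennreal_toReal.aestronglyMeasurable (.of_forall fun ω => by
        simp only [Pi.add_apply]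
        rw [abs_of_nonneg ENNReal.toReal_nonneg, abs_of_nonneg (by positivity)]
        exact le_add_of_nonneg_left ENNReal.toReal_nonneg)
    rw [evalFun_add hfm hgm, ENNReal.ofReal_add, ← ihf hf1 hfm, ← ihg hg1 hgm]
    · exact lintegral_add_left hf g
    · exact evalFun_nonneg hΦ (.of_forall fun ω => ENNReal.toReal_nonneg)
    · exact evalFun_nonneg hΦ (.of_forall fun ω => ENNReal.toReal_nonneg)
  · intro F hF hmono ih hfin hmem
    have hle : ∀ n ω, F n ω ≤ ⨆ n, F n ω := fun n ω => le_iSup (fun n => F n ω) n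
    have hF1 : ∀ n ω, F n ω ≠ ⊤ := fun n ω => ne_top_of_le_ne_top (hfin ω) (hle n ω)
    have hFm : ∀ n, Y.MemFun fun ω => (F n ω).toReal := fun n => hmem.of_abs_le
      (hF n).ennreal_toReal.aestronglyMeasurable (.of_forall fun ω => by
        rw [abs_of_nonneg ENNReal.toReal_nonneg, abs_of_nonneg ENNReal.toReal_nonneg]
        exact ENNReal.toReal_mono (hfin ω) (hle n ω))
    have hlim := tendsto_evalFun hY hΦ hC hFm hmem
      (.of_forall fun ω m n hmn => ENNReal.toReal_mono (hF1 n ω) (hmono hmn ω))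
      (.of_forall fun ω => (ENNReal.tendsto_toReal (hfin ω)).comp
        (tendsto_atTop_iSup fun m n hmn => hmono hmn ω))
    rw [lintegral_iSup hF hmono]
    simp only [fun n => ih n (hF1 n) (hFm n)]
    refine tendsto_nhds_unique (tendsto_atTop_iSup fun m n hmn => ?_)
      (ENNReal.tendsto_ofReal hlim)
    simp only [← fun n => ih n (hF1 n) (hFm n)]
    exact lintegral_mono (hmono hmn)

/-- A bounded positive functional on a `σ`-order continuous space is given by a function in the
Köthe dual. -/
theorem exists_memKotheDual_eq_integral [SigmaFinite μ] (hY : Y.SigmaOrderContinuous)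
    (hΦ : ∀ f : Y.carrier, 0 ≤ (f : Ω →ₘ[μ] ℝ) → 0 ≤ Φ f) {C : ℝ}
    (hC : ∀ f : Y.carrier, 0 ≤ (f : Ω →ₘ[μ] ℝ) → Φ f ≤ C * Y.qnorm f) :
    ∃ g : Ω →ₘ[μ] ℝ, 0 ≤ g ∧ Y.MemKotheDual g ∧
      ∀ f : Y.carrier, Φ f = ∫ ω, (f : Ω →ₘ[μ] ℝ) ω * g ω ∂μ := by
  obtain ⟨ν, hνs, hνμ, hν⟩ := exists_measure_lintegral_eq hY hΦ hC
  set k := ν.rnDeriv μ with hk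
  have hkm : Measurable k := Measure.measurable_rnDeriv ν μ
  have hνk : μ.withDensity k = ν := Measure.withDensity_rnDeriv_eq ν μ hνμ
  have hint : ∀ f : Ω → ℝ, Measurable f → (∀ ω, 0 ≤ f ω) → Y.MemFun f →
      ∫⁻ ω, ENNReal.ofReal (f ω) * k ω ∂μ = ENNReal.ofReal (Y.evalFun Φ f) := fun f hf h0 hfm => by
    have h1 : (fun ω => (ENNReal.ofReal (f ω)).toReal) = f :=
      funext fun ω => ENNReal.toReal_ofReal (h0 ω)
    have h2 := hν (fun ω => ENNReal.ofReal (f ω)) hf.ennreal_ofReal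
      (fun ω => ENNReal.ofReal_ne_top) (by rwa [h1])
    rw [h1, ← hνk, lintegral_withDensity_eq_lintegral_mul _ hkm hf.ennreal_ofReal] at h2
    rw [← h2]
    exact lintegral_congr fun ω => mul_comm _ _
  -- The integral of `k` over each `B n` is the finite value of the functional on its indicator, and
  -- the `B n` cover almost everything.
  have hkfin : ∀ᵐ ω ∂μ, k ω < ⊤ := by
    obtain ⟨B, hBm, -, hBmem, hB⟩ := Y.exists_disjoint_cover
    have h1 : ∀ᵐ ω ∂μ, ∀ n, ENNReal.ofReal ((B n).indicator 1 ω) * k ω < ⊤ :=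
      ae_all_iff.2 fun n => ae_lt_top
        ((measurable_one.indicator (hBm n)).ennreal_ofReal.mul hkm) (by
          rw [hint _ (measurable_one.indicator (hBm n)) (Set.indicator_nonneg (by simp)) (hBmem n)]
          exact ENNReal.ofReal_ne_top)
    rw [measure_eq_zero_iff_ae_notMem] at hB
    filter_upwards [h1, hB] with ω h1 h2
    obtain ⟨n, hn⟩ := Set.mem_iUnion.1 (Set.notMem_compl_iff.1 h2)
    simpa [hn] using h1 n
  have hgm : Measurable fun ω => (k ω).toReal := hkm.ennreal_toReal
  set g : Ω →ₘ[μ] ℝ := AEEqFun.mk (fun ω => (k ω).toReal) hgm.aestronglyMeasurable with hg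
  have hgae : g =ᵐ[μ] fun ω => (k ω).toReal := AEEqFun.coeFn_mk _ _
  have hg0 : 0 ≤ g := coe_nonneg_iff.2 (by
    filter_upwards [hgae] with ω h
    rw [h]
    exact ENNReal.toReal_nonneg)
  have hgk : ∀ f : Ω → ℝ, (∀ ω, 0 ≤ f ω) →
      ∫⁻ ω, ENNReal.ofReal (f ω * g ω) ∂μ = ∫⁻ ω, ENNReal.ofReal (f ω) * k ω ∂μ := fun f hf =>
    lintegral_congr_ae (by
      filter_upwards [hgae, hkfin] with ω h1 h2
      rw [h1, ENNReal.ofReal_mul (hf ω), ENNReal.ofReal_toReal h2.ne])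
  have hInt : ∀ f : Ω → ℝ, Measurable f → (∀ ω, 0 ≤ f ω) → Y.MemFun f →
      Integrable (fun ω => f ω * g ω) μ ∧ ∫ ω, f ω * g ω ∂μ = Y.evalFun Φ f :=
      fun f hf h0 hfm => by
    have hm : AEStronglyMeasurable (fun ω => f ω * g ω) μ :=
      (hf.mul g.measurable).aestronglyMeasurable
    have hnn : 0 ≤ᵐ[μ] fun ω => f ω * g ω := by
      filter_upwards [coe_nonneg_iff.1 hg0] with ω h
      exact mul_nonneg (h0 ω) h
    have hl := (hgk f h0).trans (hint f hf h0 hfm)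
    refine ⟨⟨hm, ?_⟩, ?_⟩
    · rw [hasFiniteIntegral_iff_ofReal hnn, hl]
      exact ENNReal.ofReal_lt_top
    · rw [integral_eq_lintegral_of_nonneg_ae hnn hm, hl,
        ENNReal.toReal_ofReal (evalFun_nonneg hΦ (.of_forall h0))]
  have hmemp : ∀ x : Y.carrier, Y.MemFun fun ω => max ((x : Ω →ₘ[μ] ℝ) ω) 0 := fun x =>
    (memFun_coe x).of_abs_le ((x : Ω →ₘ[μ] ℝ).measurable.max measurable_const).aestronglyMeasurable
      (.of_forall fun ω => by
        rw [abs_of_nonneg (le_max_right _ _)]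
        exact max_le (le_abs_self _) (abs_nonneg _))
  have hmemn : ∀ x : Y.carrier, Y.MemFun fun ω => max (-(x : Ω →ₘ[μ] ℝ) ω) 0 := fun x =>
    (memFun_coe x).of_abs_le
      ((x : Ω →ₘ[μ] ℝ).measurable.neg.max measurable_const).aestronglyMeasurable
      (.of_forall fun ω => by
        rw [abs_of_nonneg (le_max_right _ _)]
        exact max_le (neg_le_abs _) (abs_nonneg _))
  have hfull : ∀ x : Y.carrier, Integrable (fun ω => (x : Ω →ₘ[μ] ℝ) ω * g ω) μ ∧
      Φ x = ∫ ω, (x : Ω →ₘ[μ] ℝ) ω * g ω ∂μ := fun x => by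
    obtain ⟨hp1, hp2⟩ := hInt _ ((x : Ω →ₘ[μ] ℝ).measurable.max measurable_const)
      (fun ω => le_max_right _ _) (hmemp x)
    obtain ⟨hn1, hn2⟩ := hInt (fun ω => max (-(x : Ω →ₘ[μ] ℝ) ω) 0)
      ((x : Ω →ₘ[μ] ℝ).measurable.neg.max measurable_const)
      (fun ω => le_max_right _ _) (hmemn x)
    have hsplit : ∀ a : ℝ, max a 0 - max (-a) 0 = a := fun a => by
      rcases le_total a 0 with h | h
      · rw [max_eq_right h, max_eq_left (neg_nonneg.2 h)]
        ring
      · rw [max_eq_left h, max_eq_right (neg_nonpos.2 h)]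
        ring
    have hfun : (fun ω => (x : Ω →ₘ[μ] ℝ) ω * g ω) = fun ω =>
        max ((x : Ω →ₘ[μ] ℝ) ω) 0 * g ω - max (-(x : Ω →ₘ[μ] ℝ) ω) 0 * g ω := by
      ext ω
      rw [← sub_mul, hsplit]
    rw [hfun]
    refine ⟨hp1.sub hn1, ?_⟩
    rw [integral_sub hp1 hn1, hp2, hn2, ← evalFun_sub (hmemp x) (hmemn x)]
    refine (evalFun_eq (.of_forall fun ω => ?_)).symm
    exact (hsplit _).symm
  -- Compare `x` with its positive part. `|C|` is used since `C` has no assumed sign; the lower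
  -- bound comes later from `-x`.
  have hbound : ∀ x : Y.carrier, Φ x ≤ |C| * Y.qnorm x := fun x => by
    obtain ⟨y, hy⟩ := hmemp x
    have hy0 : 0 ≤ (y : Ω →ₘ[μ] ℝ) := coe_nonneg_iff.2 (by
      filter_upwards [hy] with ω h
      rw [h]
      exact le_max_right _ _)
    have h1 : Φ x ≤ Φ y := by
      rw [← sub_nonneg, ← map_sub]
      refine hΦ _ (coe_nonneg_iff.2 ?_)
      filter_upwards [hy, AEEqFun.coeFn_sub (y : Ω →ₘ[μ] ℝ) x] with ω h1 h2
      rw [Submodule.coe_sub, h2, Pi.sub_apply, h1, sub_nonneg]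
      exact le_max_left _ _
    have h2 : Y.qnorm y ≤ Y.qnorm x := (Y.solid y x x.2 (by
      filter_upwards [hy] with ω h
      rw [h, abs_of_nonneg (le_max_right _ _)]
      exact max_le (le_abs_self _) (abs_nonneg _))).2
    calc Φ x ≤ C * Y.qnorm y := h1.trans (hC y hy0)
      _ ≤ |C| * Y.qnorm y := by
        gcongr
        · exact Y.qnorm_nonneg _ y.2
        · exact le_abs_self C
      _ ≤ |C| * Y.qnorm x := by gcongr
  refine ⟨g, hg0, ⟨fun x hx => (hfull ⟨x, hx⟩).1, |C|, fun x hx h1 => ?_⟩, fun f => (hfull f).2⟩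
  have h2 := hbound ⟨x, hx⟩
  have h3 := hbound (-⟨x, hx⟩)
  have h4 : Y.qnorm (-x) = Y.qnorm x := by
    simpa using Y.qnorm_smul (-1) x hx
  rw [← (hfull ⟨x, hx⟩).2]
  rw [map_neg, Submodule.coe_neg, h4] at h3
  have h5 : |C| * Y.qnorm x ≤ |C| := mul_le_of_le_one_right (abs_nonneg C) h1
  exact abs_le'.2 ⟨h2.trans h5, h3.trans h5⟩

/-- Powers of `σ`-order continuous spaces are `σ`-order continuous. -/
theorem SigmaOrderContinuous.power {X : QuasiKotheSpace μ} (hX : X.SigmaOrderContinuous)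
    {r : ℝ} (hr : 0 < r) : (X.power r hr).SigmaOrderContinuous := by
  intro x hx h0 hanti hlim
  have hr' : 0 < 1 / r := by positivity
  have hae : ∀ᵐ ω ∂μ, ∀ n, absRpow (1 / r) (x n) ω = |x n ω| ^ (1 / r) :=
    ae_all_iff.2 fun n => coeFn_absRpow (1 / r) (x n)
  have hnn : ∀ᵐ ω ∂μ, ∀ n, 0 ≤ x n ω := ae_all_iff.2 fun n => coe_nonneg_iff.1 (h0 n)
  have key := hX (fun n => absRpow (1 / r) (x n)) hx (fun n => absRpow_nonneg _ _)
    (by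
      filter_upwards [hae, hnn, hanti] with ω h1 h2 h3 m n hmn
      simp only [h1]
      rw [abs_of_nonneg (h2 m), abs_of_nonneg (h2 n)]
      exact Real.rpow_le_rpow (h2 n) (h3 hmn) hr'.le)
    (by
      filter_upwards [hae, hlim] with ω h1 h2
      simp only [h1]
      simpa [Real.zero_rpow hr.ne', hr.ne'] using h2.abs.rpow_const (Or.inr hr'.le))
  have := key.rpow_const (p := r) (Or.inr hr.le)
  rwa [Real.zero_rpow hr.ne'] at this

end QuasiKotheSpace


/-! ### Separation by a linear functional, and passage from sums to products -/

/-- A convex cone in `E × ℝ` which projects onto `E` and has only nonpositive heights above `0`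
lies below the graph of a linear functional. -/
theorem exists_linearMap_ge_of_pointedCone {E : Type*} [AddCommGroup E] [Module ℝ E]
    (K : PointedCone ℝ (E × ℝ)) (hproj : ∀ v, ∃ s, (v, s) ∈ K) (hzero : ∀ s, (0, s) ∈ K → s ≤ 0) :
    ∃ F : E →ₗ[ℝ] ℝ, ∀ v s, (v, s) ∈ K → s ≤ F v := by
  let D : Submodule ℝ (E × ℝ) := LinearMap.ker (LinearMap.fst ℝ E ℝ)
  -- The functional `(0, s) ↦ -s` is nonnegative on the part of `K` above `0`. A nonnegative
  -- extension `g` satisfies `0 ≤ g (v, s) = g (v, 0) - s` on `K`.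
  let f : E × ℝ →ₗ.[ℝ] ℝ := ⟨D, -(LinearMap.snd ℝ E ℝ ∘ₗ D.subtype)⟩
  have hf : ∀ x : f.domain, f x = -(x : E × ℝ).2 := fun x => rfl
  obtain ⟨g, hg, hgK⟩ := riesz_extension K f
    (by
      rintro ⟨⟨v, s⟩, hv⟩ hK
      obtain rfl : v = 0 := hv
      rw [hf]
      exact neg_nonneg.2 (hzero s hK))
    (by
      rintro ⟨v, s⟩
      obtain ⟨s', hs'⟩ := hproj v
      refine ⟨⟨(0, s' - s), rfl⟩, ?_⟩
      simpa using hs')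
  refine ⟨g ∘ₗ LinearMap.inl ℝ E ℝ, fun v s hvs => ?_⟩
  have h1 := hgK _ hvs
  have h2 : g (0, s) = -s := by
    rw [hg ⟨(0, s), rfl⟩, hf]
  have h3 : ((v, s) : E × ℝ) = (v, 0) + (0, s) := by simp
  rw [h3, map_add, h2] at h1
  simp only [LinearMap.comp_apply, LinearMap.inl_apply]
  linarith

/-- The choice `s = 1 / A`, `w = 1 / B` makes the right side `a + b = 1`. Since `A` or `B` may
vanish, both are first enlarged by `ε`, which then tends to `0`. -/
theorem le_rpow_mul_rpow_of_forall_scale {a b v A B : ℝ} (ha : 0 < a) (hb : 0 < b)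
    (hab : a + b = 1) (hA : 0 ≤ A) (hB : 0 ≤ B)
    (h : ∀ s w : ℝ, 0 < s → 0 < w → s ^ a * w ^ b * v ≤ a * (s * A) + b * (w * B)) :
    v ≤ A ^ a * B ^ b := by
  have hε : ∀ ε : ℝ, 0 < ε → v ≤ (A + ε) ^ a * (B + ε) ^ b := fun ε hε => by
    have hA' : 0 < A + ε := by positivity
    have hB' : 0 < B + ε := by positivity
    have h1 := h (A + ε)⁻¹ (B + ε)⁻¹ (by positivity) (by positivity)
    have h2 : (A + ε)⁻¹ * A ≤ 1 := by
      rw [inv_mul_le_iff₀ hA']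
      linarith
    have h3 : (B + ε)⁻¹ * B ≤ 1 := by
      rw [inv_mul_le_iff₀ hB']
      linarith
    have h4 : (A + ε)⁻¹ ^ a * (B + ε)⁻¹ ^ b * v ≤ 1 := by
      nlinarith
    rw [Real.inv_rpow hA'.le, Real.inv_rpow hB'.le, ← mul_inv,
      inv_mul_le_iff₀ (by positivity)] at h4
    linarith
  have hlim : Tendsto (fun ε : ℝ => (A + ε) ^ a * (B + ε) ^ b) (𝓝[>] 0)
      (𝓝 ((A + 0) ^ a * (B + 0) ^ b)) := by
    refine Tendsto.mono_left (ContinuousAt.tendsto (f := fun ε : ℝ => (A + ε) ^ a * (B + ε) ^ b) ?_)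
      nhdsWithin_le_nhds
    exact ((continuousAt_const.add continuousAt_id).rpow_const (Or.inr ha.le)).mul
      ((continuousAt_const.add continuousAt_id).rpow_const (Or.inr hb.le))
  rw [add_zero, add_zero] at hlim
  exact ge_of_tendsto hlim (eventually_mem_nhdsWithin.mono hε)

/-! ### `r`-convexity and the cone of norm bounds -/

namespace QuasiKotheSpace

variable {X : QuasiKotheSpace μ} {r : ℝ}

/-- Each defining inequality survives the infimum: divide by the sum if it is positive; otherwise
any admissible constant gives the claim. -/
theorem IsRConvex.convexityConst_mem (hX : X.IsRConvex r) :
    X.convexityConst r ∈ X.convexityConstants r := by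
  refine ⟨le_csInf hX fun c hc => hc.1, fun n x hx => ?_⟩
  have h0 : 0 ≤ (∑ k, X.qnorm (x k) ^ r) ^ (1 / r) := Real.rpow_nonneg
    (Finset.sum_nonneg fun k _ => Real.rpow_nonneg (X.qnorm_nonneg _ (hx k)) _) _
  rcases h0.eq_or_lt with h0 | h0
  · obtain ⟨c, hc⟩ := hX
    have h1 := hc.2 n x hx
    rw [← h0, mul_zero] at h1 ⊢
    exact h1
  · rw [← div_le_iff₀ h0]
    exact le_csInf hX fun c hc => (div_le_iff₀ h0).2 (hc.2 n x hx)

theorem toPower_smul (hr : 0 < r) (a : ℝ) (x : X.carrier) :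
    X.toPower r hr (a • x) = |a| ^ r • X.toPower r hr x :=
  Subtype.ext (absRpow_smul a (x : Ω →ₘ[μ] ℝ))

theorem toPower_nonneg (hr : 0 < r) (x : X.carrier) : 0 ≤ (X.toPower r hr x : Ω →ₘ[μ] ℝ) :=
  absRpow_nonneg _ _

theorem coe_sum_toPower (hr : 0 < r) {n : ℕ} (x : Fin n → X.carrier) :
    ((∑ k, X.toPower r hr (x k) : (X.power r hr).carrier) : Ω →ₘ[μ] ℝ) =
      ∑ k, absRpow r (x k : Ω →ₘ[μ] ℝ) := by
  rw [Submodule.coe_sum]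
  rfl

theorem lrSum_mem (hr : 0 < r) {n : ℕ} (x : Fin n → X.carrier) :
    lrSum r (fun k => (x k : Ω →ₘ[μ] ℝ)) ∈ X.carrier := by
  have h := (∑ k, X.toPower r hr (x k)).2
  rw [coe_sum_toPower] at h
  exact h

theorem sum_toPower_nonneg (hr : 0 < r) {n : ℕ} (x : Fin n → X.carrier) :
    0 ≤ ((∑ k, X.toPower r hr (x k) : (X.power r hr).carrier) : Ω →ₘ[μ] ℝ) := by
  rw [Submodule.coe_sum]
  refine Finset.sum_induction _ (fun f : Ω →ₘ[μ] ℝ => 0 ≤ f) (fun f g hf hg => ?_) le_rfl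
    fun k _ => toPower_nonneg hr (x k)
  rw [coe_nonneg_iff]
  filter_upwards [coe_nonneg_iff.1 hf, coe_nonneg_iff.1 hg, AEEqFun.coeFn_add f g] with ω h1 h2 h3
  rw [h3]
  exact add_nonneg h1 h2

theorem power_qnorm_sum_toPower (hr : 0 < r) {n : ℕ} (x : Fin n → X.carrier) :
    (X.power r hr).qnorm ((∑ k, X.toPower r hr (x k) : (X.power r hr).carrier) : Ω →ₘ[μ] ℝ) =
      X.qnorm (lrSum r fun k => (x k : Ω →ₘ[μ] ℝ)) ^ r := by
  rw [coe_sum_toPower]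
  rfl

theorem IsRConvex.power_qnorm_sum_le (hX : X.IsRConvex r) (hr : 0 < r) {n : ℕ}
    (x : Fin n → X.carrier) :
    (X.power r hr).qnorm ((∑ k, X.toPower r hr (x k) : (X.power r hr).carrier) : Ω →ₘ[μ] ℝ) ≤
      X.convexityConst r ^ r * ∑ k, X.qnorm (x k) ^ r := by
  have hs : 0 ≤ ∑ k, X.qnorm (x k) ^ r :=
    Finset.sum_nonneg fun k _ => Real.rpow_nonneg (X.qnorm_nonneg _ (x k).2) _
  rw [power_qnorm_sum_toPower]
  refine (Real.rpow_le_rpow (X.qnorm_nonneg _ (lrSum_mem hr x))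
    (hX.convexityConst_mem.2 n _ fun k => (x k).2) hr.le).trans_eq ?_
  rw [Real.mul_rpow hX.convexityConst_mem.1 (Real.rpow_nonneg hs _), ← Real.rpow_mul hs,
    one_div_mul_cancel hr.ne', Real.rpow_one]

theorem qnorm_le_of_le {Y : QuasiKotheSpace μ} {f g : Ω →ₘ[μ] ℝ} (hg : g ∈ Y.carrier) (h0 : 0 ≤ f)
    (h : f ≤ g) : Y.qnorm f ≤ Y.qnorm g := by
  refine (Y.solid f g hg ?_).2
  filter_upwards [coe_nonneg_iff.1 h0, coe_nonneg_iff.1 (h0.trans h), AEEqFun.coeFn_le.2 h]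
    with ω h1 h2 h3
  rwa [abs_of_nonneg h1, abs_of_nonneg h2]

/-- The cone of pairs `(f, s)` with `-f ≤ ∑ |zᵢ|^r` and `s ≤ -c ∑ ‖zᵢ‖^r` for some `zᵢ ∈ X`. -/
noncomputable def boundCone (X : QuasiKotheSpace μ) {r : ℝ} (hr : 0 < r) (c : ℝ) :
    PointedCone ℝ ((X.power r hr).carrier × ℝ) where
  carrier := {p | ∃ (n : ℕ) (z : Fin n → X.carrier),
    0 ≤ ((p.1 + ∑ i, X.toPower r hr (z i) : (X.power r hr).carrier) : Ω →ₘ[μ] ℝ) ∧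
      p.2 ≤ -(c * ∑ i, X.qnorm (z i) ^ r)}
  add_mem' := by
    rintro ⟨f, a⟩ ⟨g, b⟩ ⟨m, z, h1, h2⟩ ⟨n, w, h3, h4⟩
    refine ⟨m + n, Fin.append z w, ?_, ?_⟩
    · rw [Fin.sum_univ_add]
      simp only [Fin.append_left, Fin.append_right, Prod.fst_add]
      rw [add_add_add_comm, Submodule.coe_add, coe_nonneg_iff]
      filter_upwards [coe_nonneg_iff.1 h1, coe_nonneg_iff.1 h3, AEEqFun.coeFn_add
        ((f + ∑ i, X.toPower r hr (z i) : (X.power r hr).carrier) : Ω →ₘ[μ] ℝ)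
        (g + ∑ i, X.toPower r hr (w i) : (X.power r hr).carrier)] with ω h1 h2 h3
      rw [h3]
      exact add_nonneg h1 h2
    · rw [Fin.sum_univ_add]
      simp only [Fin.append_left, Fin.append_right, Prod.snd_add] at *
      linarith
  zero_mem' := ⟨0, Fin.elim0, by simp, by simp⟩
  smul_mem' := by
    rintro ⟨a, ha⟩ ⟨f, s⟩ ⟨n, z, h1, h2⟩
    have ha' : |a ^ (1 / r)| ^ r = a := by
      rw [abs_of_nonneg (Real.rpow_nonneg ha _), ← Real.rpow_mul ha, one_div_mul_cancel hr.ne',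
        Real.rpow_one]
    -- Both `|z|^r` and `‖z‖^r` are homogeneous of degree `r`.
    refine ⟨n, fun i => a ^ (1 / r) • z i, ?_, ?_⟩
    · simp only [toPower_smul, ha', ← Finset.smul_sum]
      change 0 ≤ ((a • f + a • ∑ i, X.toPower r hr (z i) : (X.power r hr).carrier) : Ω →ₘ[μ] ℝ)
      rw [← smul_add, Submodule.coe_smul, coe_nonneg_iff]
      filter_upwards [coe_nonneg_iff.1 h1, AEEqFun.coeFn_smul a
        ((f + ∑ i, X.toPower r hr (z i) : (X.power r hr).carrier) : Ω →ₘ[μ] ℝ)] with ω h1 h2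
      rw [h2]
      exact mul_nonneg ha h1
    · have h3 : ∀ i, X.qnorm ((a ^ (1 / r) • z i : X.carrier) : Ω →ₘ[μ] ℝ) ^ r =
          a * X.qnorm (z i) ^ r := fun i => by
        rw [Submodule.coe_smul, X.qnorm_smul _ _ (z i).2,
          Real.mul_rpow (abs_nonneg _) (X.qnorm_nonneg _ (z i).2), ha']
      simp only [h3, ← Finset.mul_sum]
      change a * s ≤ _
      have := mul_le_mul_of_nonneg_left h2 ha
      simp only at this
      linarith

section boundCone

variable (hr : 0 < r)

theorem mem_boundCone_of_nonneg (c : ℝ) {f : (X.power r hr).carrier} (hf : 0 ≤ (f : Ω →ₘ[μ] ℝ)) :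
    (f, (0 : ℝ)) ∈ X.boundCone hr c :=
  ⟨0, Fin.elim0, by simpa using hf, by simp⟩

theorem neg_toPower_mem_boundCone (c : ℝ) (x : X.carrier) :
    (-X.toPower r hr x, -(c * X.qnorm x ^ r)) ∈ X.boundCone hr c :=
  ⟨1, fun _ => x, by simp, by simp⟩

theorem exists_mem_boundCone (c : ℝ) (f : (X.power r hr).carrier) : ∃ s, (f, s) ∈ X.boundCone hr c := by
  -- With `z = |f|^(1/r)` the required positivity is `f + |f| ≥ 0`.
  refine ⟨_, 1, fun _ => ⟨absRpow (1 / r) (f : Ω →ₘ[μ] ℝ), f.2⟩, ?_, le_rfl⟩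
  simp only [Fin.sum_univ_one]
  rw [Submodule.coe_add, coe_nonneg_iff]
  filter_upwards [coeFn_absRpow r (absRpow (1 / r) (f : Ω →ₘ[μ] ℝ)),
    coeFn_absRpow (1 / r) (f : Ω →ₘ[μ] ℝ), AEEqFun.coeFn_add (f : Ω →ₘ[μ] ℝ)
    (absRpow r (absRpow (1 / r) (f : Ω →ₘ[μ] ℝ)))] with ω h1 h2 h3
  change 0 ≤ ((f : Ω →ₘ[μ] ℝ) + absRpow r (absRpow (1 / r) (f : Ω →ₘ[μ] ℝ)) : Ω →ₘ[μ] ℝ) ω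
  rw [h3, Pi.add_apply, h1, h2, abs_of_nonneg (Real.rpow_nonneg (abs_nonneg _) _),
    ← Real.rpow_mul (abs_nonneg _), one_div_mul_cancel hr.ne', Real.rpow_one]
  linarith [neg_abs_le ((f : Ω →ₘ[μ] ℝ) ω)]

/-- Membership provides `f ≤ ∑ |zᵢ|^r`; monotonicity and `r`-convexity then bound the quasi norm of
`f` by `M^r ∑ ‖zᵢ‖^r`. -/
theorem IsRConvex.le_of_mem_boundCone (hX : X.IsRConvex r) {a : ℝ} (ha : 0 ≤ a)
    {f : (X.power r hr).carrier}
    (hf : 0 ≤ (f : Ω →ₘ[μ] ℝ)) {s : ℝ} (h : (-f, s) ∈ X.boundCone hr (a * X.convexityConst r ^ r)) :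
    s ≤ -(a * (X.power r hr).qnorm f) := by
  obtain ⟨n, z, h1, h2⟩ := h
  refine h2.trans ?_
  have h3 : (f : Ω →ₘ[μ] ℝ) ≤ (∑ i, X.toPower r hr (z i) : (X.power r hr).carrier) := by
    rw [← AEEqFun.coeFn_le]
    filter_upwards [coe_nonneg_iff.1 h1, AEEqFun.coeFn_add ((-f : (X.power r hr).carrier) : Ω →ₘ[μ] ℝ)
      (∑ i, X.toPower r hr (z i) : (X.power r hr).carrier), AEEqFun.coeFn_neg (f : Ω →ₘ[μ] ℝ)]
      with ω h1 h2 h3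
    rw [Submodule.coe_add, h2, Pi.add_apply, Submodule.coe_neg, h3, Pi.neg_apply] at h1
    linarith
  have h4 := (qnorm_le_of_le (Subtype.coe_prop _) hf h3).trans (hX.power_qnorm_sum_le hr z)
  rw [neg_le_neg_iff, mul_assoc]
  gcongr

end boundCone

end QuasiKotheSpace

open QuasiKotheSpace

/-! ### The cone of the form `u` and the separation argument -/

section bilinear

variable {𝕜 : Type*} [RCLike 𝕜] {Ω₁ Ω₂ U₁ U₂ : Type*}
    [MeasurableSpace Ω₁] [MeasurableSpace Ω₂] {μ₁ : Measure Ω₁} {μ₂ : Measure Ω₂}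
    [SMul ℝ≥0 U₁] [SMul ℝ≥0 U₂]
    {X₁ : QuasiKotheSpace μ₁} {X₂ : QuasiKotheSpace μ₂} {r₁ r₂ t : ℝ}
    {φ₁ : U₁ → X₁.carrier} {φ₂ : U₂ → X₂.carrier} {u : U₁ → U₂ → 𝕜}

/-- Used with `a = b`, where the factor is `a` because the exponents sum to `1`, to make `formCone`
a cone; used with independent `a`, `b` to pass from the sum to the product. -/
theorem norm_smul_smul_rpow
    (hu₁ : ∀ (a : ℝ≥0) (x : U₁) (y : U₂), u (a • x) y = (a : ℝ) • u x y)
    (hu₂ : ∀ (a : ℝ≥0) (x : U₁) (y : U₂), u x (a • y) = (a : ℝ) • u x y)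
    (a b : ℝ≥0) (x : U₁) (y : U₂) :
    ‖u (a ^ (1 / r₁) • x) (b ^ (1 / r₂) • y)‖ ^ t =
      (a : ℝ) ^ (t / r₁) * (b : ℝ) ^ (t / r₂) * ‖u x y‖ ^ t := by
  rw [hu₁, hu₂, norm_smul, norm_smul, Real.norm_of_nonneg (NNReal.coe_nonneg _),
    Real.norm_of_nonneg (NNReal.coe_nonneg _), NNReal.coe_rpow, NNReal.coe_rpow,
    Real.mul_rpow (by positivity) (by positivity), Real.mul_rpow (by positivity) (by positivity),
    ← Real.rpow_mul (NNReal.coe_nonneg a), ← Real.rpow_mul (NNReal.coe_nonneg b), mul_assoc,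
    one_div_mul_eq_div, one_div_mul_eq_div]

theorem toPower_map_smul {U : Type*} [SMul ℝ≥0 U] {Ω : Type*} [MeasurableSpace Ω] {μ : Measure Ω}
    {X : QuasiKotheSpace μ} {φ : U → X.carrier} {r : ℝ} (hr : 0 < r)
    (hφ : ∀ (a : ℝ≥0) (x : U), φ (a • x) = (a : ℝ) • φ x) (a : ℝ≥0) (x : U) :
    X.toPower r hr (φ (a ^ (1 / r) • x)) = (a : ℝ) • X.toPower r hr (φ x) := by
  rw [hφ, toPower_smul, abs_of_nonneg (NNReal.coe_nonneg _), NNReal.coe_rpow,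
    ← Real.rpow_mul (NNReal.coe_nonneg a), one_div_mul_cancel hr.ne', Real.rpow_one]

/-- The cone of triples `((∑ |φ₁(xₖ)|^r₁, ∑ |φ₂(yₖ)|^r₂), ∑ |u(xₖ, yₖ)|^t)`. -/
noncomputable def formCone (hr₁ : 0 < r₁) (hr₂ : 0 < r₂) (ht : t / r₁ + t / r₂ = 1)
    (hφ₁ : ∀ (a : ℝ≥0) (x : U₁), φ₁ (a • x) = (a : ℝ) • φ₁ x)
    (hφ₂ : ∀ (a : ℝ≥0) (y : U₂), φ₂ (a • y) = (a : ℝ) • φ₂ y)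
    (hu₁ : ∀ (a : ℝ≥0) (x : U₁) (y : U₂), u (a • x) y = (a : ℝ) • u x y)
    (hu₂ : ∀ (a : ℝ≥0) (x : U₁) (y : U₂), u x (a • y) = (a : ℝ) • u x y) :
    PointedCone ℝ (((X₁.power r₁ hr₁).carrier × (X₂.power r₂ hr₂).carrier) × ℝ) where
  carrier := {p | ∃ (n : ℕ) (x : Fin n → U₁) (y : Fin n → U₂),
    p = ((∑ k, X₁.toPower r₁ hr₁ (φ₁ (x k)), ∑ k, X₂.toPower r₂ hr₂ (φ₂ (y k))),
      ∑ k, ‖u (x k) (y k)‖ ^ t)}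
  add_mem' := by
    rintro _ _ ⟨m, x, y, rfl⟩ ⟨n, z, w, rfl⟩
    refine ⟨m + n, Fin.append x z, Fin.append y w, ?_⟩
    simp only [Fin.sum_univ_add, Fin.append_left, Fin.append_right, Prod.mk_add_mk]
  zero_mem' := ⟨0, Fin.elim0, Fin.elim0, by simp [Prod.ext_iff]⟩
  smul_mem' := by
    rintro ⟨a, ha⟩ _ ⟨n, x, y, rfl⟩
    lift a to ℝ≥0 using ha
    refine ⟨n, fun k => a ^ (1 / r₁) • x k, fun k => a ^ (1 / r₂) • y k, ?_⟩
    have ha : ∀ c : ℝ, (a : ℝ) ^ (t / r₁) * (a : ℝ) ^ (t / r₂) * c = a * c := fun c => by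
      rw [← Real.rpow_add' (NNReal.coe_nonneg a) (by rw [ht]; exact one_ne_zero), ht, Real.rpow_one]
    simp only [toPower_map_smul hr₁ hφ₁, toPower_map_smul hr₂ hφ₂,
      norm_smul_smul_rpow hu₁ hu₂, ha, ← Finset.smul_sum, ← Finset.mul_sum]
    rfl

/-- Positive functionals `Φ₁`, `Φ₂` which dominate `|u|^t` additively. -/
theorem exists_functionals_add (hr₁ : 0 < r₁) (hr₂ : 0 < r₂) (ht0 : 0 < t)
    (ht : t / r₁ + t / r₂ = 1) (hX₁ : X₁.IsRConvex r₁) (hX₂ : X₂.IsRConvex r₂)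
    (hφ₁ : ∀ (a : ℝ≥0) (x : U₁), φ₁ (a • x) = (a : ℝ) • φ₁ x)
    (hφ₂ : ∀ (a : ℝ≥0) (y : U₂), φ₂ (a • y) = (a : ℝ) • φ₂ y)
    (hu₁ : ∀ (a : ℝ≥0) (x : U₁) (y : U₂), u (a • x) y = (a : ℝ) • u x y)
    (hu₂ : ∀ (a : ℝ≥0) (x : U₁) (y : U₂), u x (a • y) = (a : ℝ) • u x y)
    (hu : ∀ (n : ℕ) (x : Fin n → U₁) (y : Fin n → U₂),
      (∑ k, ‖u (x k) (y k)‖ ^ t) ^ (1 / t) ≤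
        X₁.qnorm (lrSum r₁ fun k => (φ₁ (x k) : Ω₁ →ₘ[μ₁] ℝ)) *
          X₂.qnorm (lrSum r₂ fun k => (φ₂ (y k) : Ω₂ →ₘ[μ₂] ℝ))) :
    ∃ (Φ₁ : (X₁.power r₁ hr₁).carrier →ₗ[ℝ] ℝ) (Φ₂ : (X₂.power r₂ hr₂).carrier →ₗ[ℝ] ℝ),
      (∀ f : (X₁.power r₁ hr₁).carrier, 0 ≤ (f : Ω₁ →ₘ[μ₁] ℝ) → 0 ≤ Φ₁ f) ∧
      (∀ f : (X₂.power r₂ hr₂).carrier, 0 ≤ (f : Ω₂ →ₘ[μ₂] ℝ) → 0 ≤ Φ₂ f) ∧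
      (∀ x : X₁.carrier,
        Φ₁ (X₁.toPower r₁ hr₁ x) ≤ X₁.convexityConst r₁ ^ r₁ * X₁.qnorm x ^ r₁) ∧
      (∀ y : X₂.carrier,
        Φ₂ (X₂.toPower r₂ hr₂ y) ≤ X₂.convexityConst r₂ ^ r₂ * X₂.qnorm y ^ r₂) ∧
      ∀ (x : U₁) (y : U₂), ‖u x y‖ ^ t ≤ t / r₁ * Φ₁ (X₁.toPower r₁ hr₁ (φ₁ x)) +
        t / r₂ * Φ₂ (X₂.toPower r₂ hr₂ (φ₂ y)) := by
  have hθ₁ : 0 < t / r₁ := by positivity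
  have hθ₂ : 0 < t / r₂ := by positivity
  let E₁ := (X₁.power r₁ hr₁).carrier
  let E₂ := (X₂.power r₂ hr₂).carrier
  -- The weights `t / rᵢ` are those of the AM-GM inequality below; they are divided out of the
  -- functionals at the end.
  let K₁ := X₁.boundCone hr₁ (t / r₁ * X₁.convexityConst r₁ ^ r₁)
  let K₂ := X₂.boundCone hr₂ (t / r₂ * X₂.convexityConst r₂ ^ r₂)
  let i₁ : E₁ × ℝ →ₗ[ℝ] (E₁ × E₂) × ℝ := (LinearMap.inl ℝ E₁ E₂).prodMap LinearMap.id
  let i₂ : E₂ × ℝ →ₗ[ℝ] (E₁ × E₂) × ℝ := (LinearMap.inr ℝ E₁ E₂).prodMap LinearMap.id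
  let K : PointedCone ℝ ((E₁ × E₂) × ℝ) :=
    formCone hr₁ hr₂ ht hφ₁ hφ₂ hu₁ hu₂ ⊔ (K₁.map i₁ ⊔ K₂.map i₂)
  have hK₁ : ∀ f s, (f, s) ∈ K₁ → ((f, 0), s) ∈ K := fun f s h =>
    Submodule.mem_sup_right (Submodule.mem_sup_left (PointedCone.mem_map.2 ⟨_, h, rfl⟩))
  have hK₂ : ∀ f s, (f, s) ∈ K₂ → ((0, f), s) ∈ K := fun f s h =>
    Submodule.mem_sup_right (Submodule.mem_sup_right (PointedCone.mem_map.2 ⟨_, h, rfl⟩))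
  obtain ⟨F, hF⟩ := exists_linearMap_ge_of_pointedCone K
    (by
      rintro ⟨f, g⟩
      obtain ⟨a, ha⟩ := exists_mem_boundCone hr₁ (t / r₁ * X₁.convexityConst r₁ ^ r₁) f
      obtain ⟨b, hb⟩ := exists_mem_boundCone hr₂ (t / r₂ * X₂.convexityConst r₂ ^ r₂) g
      refine ⟨a + b, ?_⟩
      have := K.add_mem (hK₁ f a ha) (hK₂ g b hb)
      simpa using this)
    (by
      intro s hs
      -- Above `0` the `boundCone` parts must be `(-f, a)` and `(-g, b)`, with `f`, `g` the sums
      -- coming from `u`. The height is then at most `N₁(f)^θ₁ N₂(g)^θ₂ - θ₁ N₁(f) - θ₂ N₂(g) ≤ 0`.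
      obtain ⟨_, ⟨n, x, y, rfl⟩, _, hq, hsum⟩ := Submodule.mem_sup.1 hs
      obtain ⟨_, hq₁, _, hq₂, rfl⟩ := Submodule.mem_sup.1 hq
      obtain ⟨⟨f, a⟩, hf, rfl⟩ := PointedCone.mem_map.1 hq₁
      obtain ⟨⟨g, b⟩, hg, rfl⟩ := PointedCone.mem_map.1 hq₂
      simp only [i₁, i₂, LinearMap.prodMap_apply, LinearMap.inl_apply, LinearMap.inr_apply,
        LinearMap.id_apply, Prod.mk_add_mk, add_zero, zero_add, Prod.ext_iff,
        Prod.fst_zero, Prod.snd_zero] at hsum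
      obtain ⟨⟨h1, h2⟩, h3⟩ := hsum
      obtain rfl := eq_neg_of_add_eq_zero_right h1
      obtain rfl := eq_neg_of_add_eq_zero_right h2
      have ha := hX₁.le_of_mem_boundCone hr₁ hθ₁.le (sum_toPower_nonneg hr₁ _) hf
      have hb := hX₂.le_of_mem_boundCone hr₂ hθ₂.le (sum_toPower_nonneg hr₂ _) hg
      have hN₁ := (X₁.power r₁ hr₁).qnorm_nonneg _ (∑ k, X₁.toPower r₁ hr₁ (φ₁ (x k))).2
      have hN₂ := (X₂.power r₂ hr₂).qnorm_nonneg _ (∑ k, X₂.toPower r₂ hr₂ (φ₂ (y k))).2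
      have hAG := Real.geom_mean_le_arith_mean2_weighted hθ₁.le hθ₂.le hN₁ hN₂ ht
      have hq₁ : 0 ≤ X₁.qnorm (lrSum r₁ fun k => (φ₁ (x k) : Ω₁ →ₘ[μ₁] ℝ)) :=
        X₁.qnorm_nonneg _ (lrSum_mem hr₁ _)
      have hq₂ : 0 ≤ X₂.qnorm (lrSum r₂ fun k => (φ₂ (y k) : Ω₂ →ₘ[μ₂] ℝ)) :=
        X₂.qnorm_nonneg _ (lrSum_mem hr₂ _)
      have hS : 0 ≤ ∑ k, ‖u (x k) (y k)‖ ^ t := by positivity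
      have hle : ∑ k, ‖u (x k) (y k)‖ ^ t ≤
          X₁.qnorm (lrSum r₁ fun k => (φ₁ (x k) : Ω₁ →ₘ[μ₁] ℝ)) ^ t *
            X₂.qnorm (lrSum r₂ fun k => (φ₂ (y k) : Ω₂ →ₘ[μ₂] ℝ)) ^ t := by
        have := Real.rpow_le_rpow (by positivity) (hu n x y) ht0.le
        rwa [← Real.rpow_mul hS, one_div_mul_cancel ht0.ne', Real.rpow_one,
          Real.mul_rpow hq₁ hq₂] at this
      rw [power_qnorm_sum_toPower] at ha hb hAG
      rw [power_qnorm_sum_toPower, ← Real.rpow_mul hq₁, ← Real.rpow_mul hq₂,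
        mul_div_cancel₀ _ hr₁.ne', mul_div_cancel₀ _ hr₂.ne'] at hAG
      linarith)
  have hF₁ : ∀ f s, (f, s) ∈ K₁ → s ≤ F (f, 0) := fun f s h => hF _ _ (hK₁ f s h)
  have hF₂ : ∀ f s, (f, s) ∈ K₂ → s ≤ F (0, f) := fun f s h => hF _ _ (hK₂ f s h)
  refine ⟨(t / r₁)⁻¹ • F ∘ₗ LinearMap.inl ℝ E₁ E₂, (t / r₂)⁻¹ • F ∘ₗ LinearMap.inr ℝ E₁ E₂,
    fun f hf => ?_, fun f hf => ?_, fun x => ?_, fun y => ?_, fun x y => ?_⟩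
  all_goals simp only [LinearMap.smul_apply, LinearMap.comp_apply, smul_eq_mul]
  · exact mul_nonneg (inv_nonneg.2 hθ₁.le) (hF₁ f 0 (mem_boundCone_of_nonneg hr₁ _ hf))
  · exact mul_nonneg (inv_nonneg.2 hθ₂.le) (hF₂ f 0 (mem_boundCone_of_nonneg hr₂ _ hf))
  · have h := hF₁ _ _ (neg_toPower_mem_boundCone hr₁ _ x)
    have hneg : ((-X₁.toPower r₁ hr₁ x, 0) : E₁ × E₂) = -(X₁.toPower r₁ hr₁ x, 0) := by simp
    rw [hneg, map_neg, neg_le_neg_iff] at h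
    rw [inv_mul_le_iff₀ hθ₁, ← mul_assoc]
    exact h
  · have h := hF₂ _ _ (neg_toPower_mem_boundCone hr₂ _ y)
    have hneg : ((0, -X₂.toPower r₂ hr₂ y) : E₁ × E₂) = -(0, X₂.toPower r₂ hr₂ y) := by simp
    rw [hneg, map_neg, neg_le_neg_iff] at h
    rw [inv_mul_le_iff₀ hθ₂, ← mul_assoc]
    exact h
  · have h := hF (X₁.toPower r₁ hr₁ (φ₁ x), X₂.toPower r₂ hr₂ (φ₂ y)) (‖u x y‖ ^ t)
      (Submodule.mem_sup_left ⟨1, fun _ => x, fun _ => y, by simp⟩)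
    have hadd : ((X₁.toPower r₁ hr₁ (φ₁ x), X₂.toPower r₂ hr₂ (φ₂ y)) : E₁ × E₂) =
        (X₁.toPower r₁ hr₁ (φ₁ x), 0) + (0, X₂.toPower r₂ hr₂ (φ₂ y)) := by simp
    rw [hadd, map_add] at h
    rwa [mul_inv_cancel_left₀ hθ₁.ne', mul_inv_cancel_left₀ hθ₂.ne']

end bilinear

/-! ### Norm bounds for the functionals -/

section bounds

variable {X : QuasiKotheSpace μ} {r : ℝ} {hr : 0 < r} {Φ : (X.power r hr).carrier →ₗ[ℝ] ℝ}

theorem rpow_le_convexityConst (hX : X.IsRConvex r)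
    (hΦ : ∀ f : (X.power r hr).carrier, 0 ≤ (f : Ω →ₘ[μ] ℝ) → 0 ≤ Φ f)
    (hΦX : ∀ x : X.carrier, Φ (X.toPower r hr x) ≤ X.convexityConst r ^ r * X.qnorm x ^ r)
    (x : X.carrier) (hx : X.qnorm x ≤ 1) :
    Φ (X.toPower r hr x) ^ (1 / r) ≤ X.convexityConst r := by
  have hM := hX.convexityConst_mem.1
  have h1 : Φ (X.toPower r hr x) ≤ X.convexityConst r ^ r :=
    (hΦX x).trans (mul_le_of_le_one_right (Real.rpow_nonneg hM r)
      (Real.rpow_le_one (X.qnorm_nonneg _ x.2) hx hr.le))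
  refine (Real.rpow_le_rpow (hΦ _ (toPower_nonneg hr x)) h1 (by positivity)).trans_eq ?_
  rw [← Real.rpow_mul hM, mul_one_div_cancel hr.ne', Real.rpow_one]

/-- Every nonnegative `f` in `X^r` is `|x|^r` with `x = f^(1/r)` in `X`, so the bound on powers
covers all positive elements, as the integral representation needs. -/
theorem le_mul_power_qnorm
    (hΦX : ∀ x : X.carrier, Φ (X.toPower r hr x) ≤ X.convexityConst r ^ r * X.qnorm x ^ r)
    (f : (X.power r hr).carrier) (hf : 0 ≤ (f : Ω →ₘ[μ] ℝ)) :
    Φ f ≤ X.convexityConst r ^ r * (X.power r hr).qnorm f := by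
  have h1 : X.toPower r hr ⟨absRpow (1 / r) (f : Ω →ₘ[μ] ℝ), f.2⟩ = f := by
    refine Subtype.ext (AEEqFun.ext ?_)
    change absRpow r (absRpow (1 / r) (f : Ω →ₘ[μ] ℝ)) =ᵐ[μ] f
    rw [absRpow_absRpow, one_div_mul_cancel hr.ne']
    filter_upwards [coeFn_absRpow 1 (f : Ω →ₘ[μ] ℝ), coe_nonneg_iff.1 hf] with ω h1 h2
    rw [h1, Real.rpow_one, abs_of_nonneg h2]
  have h2 := hΦX ⟨absRpow (1 / r) (f : Ω →ₘ[μ] ℝ), f.2⟩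
  rw [h1] at h2
  exact h2

end bounds

end Kothe

/-! ### The main theorem -/

theorem theorem1 {𝕜 : Type*} [RCLike 𝕜] {Ω₁ Ω₂ U₁ U₂ : Type*}
    [MeasurableSpace Ω₁] [MeasurableSpace Ω₂]
    {μ₁ : Measure Ω₁} {μ₂ : Measure Ω₂} [SigmaFinite μ₁] [SigmaFinite μ₂]
    [SMul ℝ≥0 U₁] [SMul ℝ≥0 U₂]
    (X₁ : Kothe.QuasiKotheSpace μ₁) (X₂ : Kothe.QuasiKotheSpace μ₂)
    (r₁ r₂ t : ℝ) (hr₁ : 0 < r₁) (hr₂ : 0 < r₂) (ht : 1 / t = 1 / r₁ + 1 / r₂)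
    (hX₁ : X₁.IsRConvex r₁) (hX₂ : X₂.IsRConvex r₂)
    (φ₁ : U₁ → X₁.carrier) (hφ₁ : ∀ (a : ℝ≥0) (x : U₁), φ₁ (a • x) = (a : ℝ) • φ₁ x)
    (φ₂ : U₂ → X₂.carrier) (hφ₂ : ∀ (a : ℝ≥0) (y : U₂), φ₂ (a • y) = (a : ℝ) • φ₂ y)
    (u : U₁ → U₂ → 𝕜)
    (hu₁ : ∀ (a : ℝ≥0) (x : U₁) (y : U₂), u (a • x) y = (a : ℝ) • u x y)
    (hu₂ : ∀ (a : ℝ≥0) (x : U₁) (y : U₂), u x (a • y) = (a : ℝ) • u x y)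
    (hu : ∀ (n : ℕ) (x : Fin n → U₁) (y : Fin n → U₂),
      (∑ k, ‖u (x k) (y k)‖ ^ t) ^ (1 / t) ≤
        X₁.qnorm (Kothe.lrSum r₁ fun k => (φ₁ (x k) : Ω₁ →ₘ[μ₁] ℝ)) *
          X₂.qnorm (Kothe.lrSum r₂ fun k => (φ₂ (y k) : Ω₂ →ₘ[μ₂] ℝ))) :
    ∃ (Φ₁ : (X₁.power r₁ hr₁).carrier →ₗ[ℝ] ℝ) (Φ₂ : (X₂.power r₂ hr₂).carrier →ₗ[ℝ] ℝ),
      (∀ f : (X₁.power r₁ hr₁).carrier, 0 ≤ (f : Ω₁ →ₘ[μ₁] ℝ) → 0 ≤ Φ₁ f) ∧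
      (∀ f : (X₂.power r₂ hr₂).carrier, 0 ≤ (f : Ω₂ →ₘ[μ₂] ℝ) → 0 ≤ Φ₂ f) ∧
      (∀ x : X₁.carrier, X₁.qnorm x ≤ 1 →
        Φ₁ (X₁.toPower r₁ hr₁ x) ^ (1 / r₁) ≤ X₁.convexityConst r₁) ∧
      (∀ y : X₂.carrier, X₂.qnorm y ≤ 1 →
        Φ₂ (X₂.toPower r₂ hr₂ y) ^ (1 / r₂) ≤ X₂.convexityConst r₂) ∧
      (∀ (x : U₁) (y : U₂), ‖u x y‖ ≤
        Φ₁ (X₁.toPower r₁ hr₁ (φ₁ x)) ^ (1 / r₁) * Φ₂ (X₂.toPower r₂ hr₂ (φ₂ y)) ^ (1 / r₂)) ∧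
      (X₁.SigmaOrderContinuous → ∃ g : Ω₁ →ₘ[μ₁] ℝ, 0 ≤ g ∧ (X₁.power r₁ hr₁).MemKotheDual g ∧
        ∀ f, Φ₁ f = ∫ ω, (f : Ω₁ →ₘ[μ₁] ℝ) ω * g ω ∂μ₁) ∧
      (X₂.SigmaOrderContinuous → ∃ g : Ω₂ →ₘ[μ₂] ℝ, 0 ≤ g ∧ (X₂.power r₂ hr₂).MemKotheDual g ∧
        ∀ f, Φ₂ f = ∫ ω, (f : Ω₂ →ₘ[μ₂] ℝ) ω * g ω ∂μ₂) := by
  have ht0 : 0 < t := one_div_pos.1 (by rw [ht]; positivity)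
  have ht1 : t / r₁ + t / r₂ = 1 := by
    have h := congrArg (t * ·) ht
    simp only [mul_add, mul_one_div, div_self ht0.ne'] at h
    exact h.symm
  obtain ⟨Φ₁, Φ₂, hp₁, hp₂, hb₁, hb₂, hΦ⟩ := Kothe.exists_functionals_add hr₁ hr₂ ht0 ht1 hX₁ hX₂
    hφ₁ hφ₂ hu₁ hu₂ hu
  refine ⟨Φ₁, Φ₂, hp₁, hp₂, Kothe.rpow_le_convexityConst hX₁ hp₁ hb₁,
    Kothe.rpow_le_convexityConst hX₂ hp₂ hb₂, fun x y => ?_,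
    fun h => Kothe.QuasiKotheSpace.exists_memKotheDual_eq_integral (h.power hr₁) hp₁
      (Kothe.le_mul_power_qnorm hb₁),
    fun h => Kothe.QuasiKotheSpace.exists_memKotheDual_eq_integral (h.power hr₂) hp₂
      (Kothe.le_mul_power_qnorm hb₂)⟩
  have hA := hp₁ _ (Kothe.QuasiKotheSpace.toPower_nonneg hr₁ (φ₁ x))
  have hB := hp₂ _ (Kothe.QuasiKotheSpace.toPower_nonneg hr₂ (φ₂ y))
  have h1 : ‖u x y‖ ^ t ≤ Φ₁ (X₁.toPower r₁ hr₁ (φ₁ x)) ^ (t / r₁) *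
      Φ₂ (X₂.toPower r₂ hr₂ (φ₂ y)) ^ (t / r₂) := by
    -- Apply the additive bound to `s^(1/r₁) x` and `w^(1/r₂) y`: the functionals scale by `s` and
    -- `w`, and `|u|^t` by `s^(t/r₁) w^(t/r₂)`.
    refine Kothe.le_rpow_mul_rpow_of_forall_scale (by positivity) (by positivity) ht1 hA hB
      fun s w hs hw => ?_
    lift s to ℝ≥0 using hs.le
    lift w to ℝ≥0 using hw.le
    have h := hΦ (s ^ (1 / r₁) • x) (w ^ (1 / r₂) • y)
    rwa [Kothe.norm_smul_smul_rpow hu₁ hu₂, Kothe.toPower_map_smul hr₁ hφ₁,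
      Kothe.toPower_map_smul hr₂ hφ₂, map_smul, map_smul, smul_eq_mul, smul_eq_mul] at h
  have h2 := Real.rpow_le_rpow (by positivity) h1 (one_div_pos.2 ht0).le
  rw [Real.mul_rpow (by positivity) (by positivity), ← Real.rpow_mul (norm_nonneg _),
    ← Real.rpow_mul hA, ← Real.rpow_mul hB, mul_one_div_cancel ht0.ne', Real.rpow_one] at h2
  have e : ∀ r : ℝ, t / r * (1 / t) = 1 / r := fun r => by
    rw [div_mul_div_comm, mul_one, mul_comm r, div_mul_cancel_left₀ ht0.ne', one_div]
  rwa [e, e] at h2
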